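/- Let $n\ge 2$. Let $\mathcal M$ be the set of symbols $a_{i_1,\dots,i_k}$ with $1\le k\le n-1$ and $1\le i_1<\dots<i_k\le n$, ordered by $a_{i_1,\dots,i_k}\le a_{j_1,\dots,j_l}$ if and only if $k\ge l$ and $i_r\le j_r$ for all $1\le r\le l$; this is a finite distributive lattice. Let $R=\mathbb C[X_a : a\in\mathcal M]$ and consider the following ideals of $R$: the ideal $I$ of Plücker relations of the variety of complete flags in $\mathbb C^n$, that is, the kernel of the homomorphism $R\to\mathbb C[z_{i,j}: 1\le i,j\le n]$ sending $X_{a_{i_1,\dots,i_k}}$ to the determinant $\det(z_{r,i_s})_{1\le r,s\le k}$; the Hibi ideal $I^h(\mathcal M)$, generated by all $X_aX_b-X_{a\vee b}X_{a\wedge b}$ with $a,b\in\mathcal M$; and the monomial ideal $I^m(\mathcal M)$, generated by all products $X_aX_b$ with $a,b\in\mathcal M$ incomparable. For $w\in\mathbb R^{\mathcal M}$ and $p\in R$ let $\mathrm{in}_w p$ be the sum of those terms of $p$ whose exponent vectors $d$ have the least value of $\sum_{a} w_a d_a$ among all terms of $p$ (with $\mathrm{in}_w 0=0$), let $\mathrm{in}_w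 I$ be the $\mathbb C$-linear span of $\{\mathrm{in}_w p : p\in I\}$, and for an ideal $J\subset R$ let $C(I,J)=\{w\in\mathbb R^{\mathcal M} : \mathrm{in}_w I=J\}$, with closure $\overline{C(I,J)}$ in $\mathbb R^{\mathcal M}$. Theorem. Every facet $F$ (face of codimension one) of the closed polyhedral cone $\overline{C(I,I^m(\mathcal M))}$ either contains the closed polyhedral cone $\overline{C(I,I^h(\mathcal M))}$ (the closed cone of the Gelfand–Tsetlin toric degeneration) or is such that $F\cap\overline{C(I,I^h(\mathcal M))}$ is a facet of $\overline{C(I,I^h(\mathcal M))}$. -/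

import Mathlib

noncomputable section

/-! ### Initial ideals and Gröbner cones -/

section Groebner

variable {σ : Type*}

/-- The initial part of `p` with respect to `w`: the sum of those terms of `p` whose exponent
vectors `d` minimise `(w, d) = ∑ i, d i * w i` over the support of `p`. -/
def initialPart (w : σ → ℝ) (p : MvPolynomial σ ℂ) : MvPolynomial σ ℂ :=
  open Classical in
  ∑ d ∈ p.support with ∀ e ∈ p.support, Finsupp.weight w d ≤ Finsupp.weight w e,
    MvPolynomial.monomial d (p.coeff d)

/-- The initial ideal of `I` with respect to `w`: the complex linear span of the initial parts
of all elements of `I`. -/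
def initialSpan (w : σ → ℝ) (I : Ideal (MvPolynomial σ ℂ)) : Submodule ℂ (MvPolynomial σ ℂ) :=
  Submodule.span ℂ {q | ∃ p ∈ I, initialPart w p = q}

/-- The set `C(I, J)` of all weights `w` such that the initial ideal of `I` is `J`. -/
def groebnerCone (I J : Ideal (MvPolynomial σ ℂ)) : Set (σ → ℝ) :=
  {w | initialSpan w I = J.restrictScalars ℂ}

end Groebner

/-! ### Hibi ideals and ideals of non-standard monomials -/

/-- The Hibi ideal of a lattice, generated by all `X a * X b - X (a ⊔ b) * X (a ⊓ b)`. -/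
def hibiIdeal (L : Type*) [Lattice L] : Ideal (MvPolynomial L ℂ) :=
  Ideal.span {q | ∃ a b : L, q = MvPolynomial.X a * MvPolynomial.X b -
    MvPolynomial.X (a ⊔ b) * MvPolynomial.X (a ⊓ b)}

/-- The monomial ideal generated by the products `X a * X b` with `a`, `b` incomparable. -/
def nonstandardIdeal (L : Type*) [Lattice L] : Ideal (MvPolynomial L ℂ) :=
  Ideal.span {q | ∃ a b : L, ¬ a ≤ b ∧ ¬ b ≤ a ∧ q = MvPolynomial.X a * MvPolynomial.X b}

/-! ### Plücker variables -/

/-- The index of a Plücker variable: a tuple `i₁ < … < i_k` of elements of an `n`-element chain,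
where `1 ≤ k ≤ n - 1`. -/
structure PluckerIndex (n : ℕ) where
  /-- The number `k` of subscripts. -/
  len : ℕ
  len_pos : 0 < len
  len_lt : len < n
  /-- The subscripts, numbered from `0`. -/
  entry : Fin len → Fin n
  strictMono : StrictMono entry

namespace PluckerIndex

variable {n : ℕ}

/-- `a_{i₁,…,i_k} ≤ a_{j₁,…,j_l}` means that `k ≥ l` and `i_r ≤ j_r` for all `r ≤ l`. -/
instance : LE (PluckerIndex n) where
  le a b := ∃ h : b.len ≤ a.len, ∀ r : Fin b.len, a.entry (Fin.castLE h r) ≤ b.entry r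

/-- The meet: the longer length, and termwise minima (of the terms that exist). -/
protected def inf (a b : PluckerIndex n) : PluckerIndex n where
  len := max a.len b.len
  len_pos := lt_max_of_lt_left a.len_pos
  len_lt := max_lt a.len_lt b.len_lt
  entry r :=
    if ha : r.1 < a.len then
      if hb : r.1 < b.len then min (a.entry ⟨r, ha⟩) (b.entry ⟨r, hb⟩) else a.entry ⟨r, ha⟩
    else b.entry ⟨r, (lt_max_iff.1 r.2).resolve_left ha⟩
  strictMono := by
    intro r s hrs
    have hrs' : r.1 < s.1 := hrs
    have hA : ∀ (h : r.1 < a.len) (h' : s.1 < a.len), a.entry ⟨r, h⟩ < a.entry ⟨s, h'⟩ :=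
      fun h h' => a.strictMono hrs
    have hB : ∀ (h : r.1 < b.len) (h' : s.1 < b.len), b.entry ⟨r, h⟩ < b.entry ⟨s, h'⟩ :=
      fun h h' => b.strictMono hrs
    have h1 := r.2
    have h2 := s.2
    rw [lt_max_iff] at h1 h2
    dsimp only
    split_ifs <;> grind

/-- The join: the shorter length, and termwise maxima. -/
protected def sup (a b : PluckerIndex n) : PluckerIndex n where
  len := min a.len b.len
  len_pos := lt_min a.len_pos b.len_pos
  len_lt := min_lt_of_left_lt a.len_lt
  entry r := max (a.entry (Fin.castLE (min_le_left _ _) r))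
    (b.entry (Fin.castLE (min_le_right _ _) r))
  strictMono := fun _ _ hrs => max_lt_max (a.strictMono hrs) (b.strictMono hrs)

theorem le_def (a b : PluckerIndex n) : a ≤ b ↔ b.len ≤ a.len ∧
    ∀ (r : ℕ) (ha : r < a.len) (hb : r < b.len), a.entry ⟨r, ha⟩ ≤ b.entry ⟨r, hb⟩ :=
  ⟨fun ⟨h, h'⟩ => ⟨h, fun r _ hb => h' ⟨r, hb⟩⟩,
    fun ⟨h, h'⟩ => ⟨h, fun r => h' r.1 (r.2.trans_le h) r.2⟩⟩

/-- The poset of Plücker variables is a distributive lattice. -/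
instance : DistribLattice (PluckerIndex n) where
  le_refl a := ⟨le_rfl, fun _ => le_rfl⟩
  le_trans a b c hab hbc := by
    rw [le_def] at *
    exact ⟨hbc.1.trans hab.1, fun r ha hc =>
      (hab.2 r ha (hc.trans_le hbc.1)).trans (hbc.2 r _ hc)⟩
  le_antisymm a b hab hba := by
    rw [le_def] at hab hba
    obtain ⟨k, _, _, f, _⟩ := a
    obtain ⟨l, _, _, g, _⟩ := b
    obtain rfl : k = l := le_antisymm hba.1 hab.1
    obtain rfl : f = g := funext fun r => le_antisymm (hab.2 r.1 r.2 r.2) (hba.2 r.1 r.2 r.2)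
    rfl
  inf := PluckerIndex.inf
  sup := PluckerIndex.sup
  inf_le_left a b := by
    rw [le_def]
    refine ⟨le_max_left _ _, fun r h1 h2 => ?_⟩
    simp only [PluckerIndex.inf]
    split_ifs <;> simp
  inf_le_right a b := by
    rw [le_def]
    refine ⟨le_max_right _ _, fun r h1 h2 => ?_⟩
    simp only [PluckerIndex.inf]
    split_ifs <;> simp
  le_inf a b c hab hac := by
    rw [le_def] at *
    refine ⟨max_le hab.1 hac.1, fun r h1 h2 => ?_⟩
    simp only [PluckerIndex.inf]
    split_ifs with h3 h4
    · exact le_min (hab.2 r h1 h3) (hac.2 r h1 h4)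
    · exact hab.2 r h1 h3
    · exact hac.2 r h1 _
  le_sup_left a b := by
    rw [le_def]
    exact ⟨min_le_left _ _, fun r h1 h2 => le_max_left _ _⟩
  le_sup_right a b := by
    rw [le_def]
    exact ⟨min_le_right _ _, fun r h1 h2 => le_max_right _ _⟩
  sup_le a b c hac hbc := by
    rw [le_def] at *
    exact ⟨le_min hac.1 hbc.1, fun r h1 h2 =>
      max_le (hac.2 r (h2.trans_le hac.1) h2) (hbc.2 r (h2.trans_le hbc.1) h2)⟩
  le_sup_inf a b c := by
    change PluckerIndex.inf (PluckerIndex.sup a b) (PluckerIndex.sup a c) ≤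
      PluckerIndex.sup a (PluckerIndex.inf b c)
    rw [le_def]
    refine ⟨?_, fun r h1 h2 => ?_⟩
    · simp only [PluckerIndex.inf, PluckerIndex.sup]; omega
    · simp only [PluckerIndex.inf, PluckerIndex.sup, Fin.castLE_mk] at h1 h2 ⊢
      grind

end PluckerIndex

/-- The ideal of Plücker relations of the variety of complete flags in `ℂⁿ`: all polynomial
relations between the minors of a generic `n × n` matrix `(z_{i,j})` which send `X_{i₁,…,i_k}` to
the minor formed by the rows `1, …, k` and the columns `i₁, …, i_k`. -/
def pluckerIdeal (n : ℕ) : Ideal (MvPolynomial (PluckerIndex n) ℂ) :=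
  RingHom.ker (MvPolynomial.aeval fun a : PluckerIndex n =>
    Matrix.det (Matrix.of fun r s : Fin a.len =>
      (MvPolynomial.X (Fin.castLE a.len_lt.le r, a.entry s) : MvPolynomial (Fin n × Fin n) ℂ)) :
    MvPolynomial (PluckerIndex n) ℂ →ₐ[ℂ] MvPolynomial (Fin n × Fin n) ℂ)

/-! ### Facets -/

/-- `F` is a facet of the polyhedron `C`: a nonempty face (the set where some linear functional
attains its maximum on `C`) whose dimension is one less than that of `C`. -/
def IsFacet {V : Type*} [AddCommGroup V] [Module ℝ V] [TopologicalSpace V] (F C : Set V) : Prop :=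
  F.Nonempty ∧ IsExposed ℝ C F ∧
    Module.finrank ℝ (vectorSpan ℝ F) + 1 = Module.finrank ℝ (vectorSpan ℝ C)

end

/-! Read a symbol `a` as the lattice path `t ↦ a.count t`, where `a.count t` is the number of
subscripts before `t`. The order becomes reversed pointwise comparison of paths, so meet and join
are the pointwise maximum and minimum.

A facet is nonempty, so some weight lies in the cone of the monomial ideal. Hence standard monomials
form a basis modulo the Plücker ideal, and each product `X_a X_b` of incomparable variables has a
straightening relation. Every term `X_c X_d` of it yields a linear form `gap`: the weight of `X_c
X_d` minus that of `X_a X_b`. The closed cone of the monomial ideal is given by all inequalities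
`gap ≥ 0`. For the Hibi ideal, the terms `X_{a ⊓ b} X_{a ⊔ b}` give equations instead, saying that
the weight is a valuation (`closure_cone_nonstandard`, `closure_cone_hibi`).

Valuations are exactly the sums of functions `G t` over the points of a path
(`exists_pathWeight_eq`). If all `G t` are strictly convex and vanish at `0`, the valuation is
induced by a weight on matrix entries that selects the diagonal term of every minor. The initial
part of each straightening relation is then the Hibi binomial (`hibi_of_initialPart_mem`), and
testing with suitable `G` shows that every other term satisfies `c ≤ a ⊓ b` (`max_count_le`).

A facet is cut out by a single `gap x`, and some point of it makes only positive multiples of `gap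
x` tight (`IsFacet.exists_inequality`). If `x` is of Hibi type, `gap x` vanishes on all valuations
and the facet contains the Hibi cone. Otherwise, straightening `X_e X_a X_b` in two ways shows that
every `e` in `[c, d]` other than `a`, `b` is comparable to both (`comparable_of_tight`). This forces
`c` to differ from `a ⊓ b` at one point only, where the paths of `a` and `b` meet, and by one
(`interval_rigid`). So on valuations `gap x` is one second difference `G s (m + 1) + G s (m - 1) - 2
G s m`. At the valuation `flatSquares s m`, any other non-Hibi inequality is strict or restricts to
the same form on valuations (`gap_flatSquares`), which makes the intersection a facet
(`isFacet_of_tight`). -/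

/-! ### Plücker indices as lattice paths -/

namespace PluckerIndex

variable {n : ℕ}

/-- The number of subscripts of `a` which are less than `t`. -/
def count (a : PluckerIndex n) (t : ℕ) : ℕ :=
  (Finset.univ.filter fun r : Fin a.len => (a.entry r).1 < t).card

/-- The entries increase, so those below `t` form an initial segment. This adjunction between
`entry` and `count` carries statements on tuples over to paths. -/
theorem entry_lt_iff (a : PluckerIndex n) (r : Fin a.len) (t : ℕ) :
    (a.entry r).1 < t ↔ r.1 < a.count t := by
  unfold count
  constructor
  · intro h
    have hsub : Finset.univ.filter (fun s : Fin a.len => s ≤ r) ⊆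
        Finset.univ.filter fun s : Fin a.len => (a.entry s).1 < t := by
      intro s hs
      simp only [Finset.mem_filter, Finset.mem_univ, true_and] at hs ⊢
      exact lt_of_le_of_lt (Fin.le_def.1 (a.strictMono.monotone hs)) h
    have hcard := Finset.card_le_card hsub
    have : (Finset.univ.filter (fun s : Fin a.len => s ≤ r)).card = r.1 + 1 := by
      rw [← Fin.card_Iic r]; congr 1; ext s; simp
    omega
  · intro h
    by_contra hr
    have hsub : (Finset.univ.filter fun s : Fin a.len => (a.entry s).1 < t) ⊆
        Finset.univ.filter (fun s : Fin a.len => s < r) := by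
      intro s hs
      simp only [Finset.mem_filter, Finset.mem_univ, true_and] at hs ⊢
      by_contra hsr
      exact hr (lt_of_le_of_lt (Fin.le_def.1 (a.strictMono.monotone (not_lt.1 hsr))) hs)
    have hcard := Finset.card_le_card hsub
    have : (Finset.univ.filter (fun s : Fin a.len => s < r)).card = r.1 := by
      rw [← Fin.card_Iio r]; congr 1; ext s; simp
    omega

theorem count_le_len (a : PluckerIndex n) (t : ℕ) : a.count t ≤ a.len := by
  unfold count
  exact (Finset.card_le_univ _).trans (by simp)

@[simp] theorem count_zero (a : PluckerIndex n) : a.count 0 = 0 := by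
  simp [count]

theorem count_of_le (a : PluckerIndex n) {t : ℕ} (ht : n ≤ t) : a.count t = a.len := by
  unfold count
  rw [Finset.filter_true_of_mem fun r _ => (a.entry r).2.trans_le ht]
  simp

theorem count_succ_iff (a : PluckerIndex n) (t m : ℕ) :
    (a.count t = m ∧ a.count (t + 1) = m + 1) ↔ ∃ h : m < a.len, (a.entry ⟨m, h⟩).1 = t := by
  constructor
  · rintro ⟨h1, h2⟩
    have h3 := a.count_le_len (t + 1)
    have hm : m < a.len := by omega
    have h4 := a.entry_lt_iff ⟨m, hm⟩ t
    have h5 := a.entry_lt_iff ⟨m, hm⟩ (t + 1)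
    simp only at h4 h5
    exact ⟨hm, by omega⟩
  · rintro ⟨hm, h⟩
    have h4 := a.entry_lt_iff ⟨m, hm⟩ t
    have h5 := a.entry_lt_iff ⟨m, hm⟩ (t + 1)
    simp only at h4 h5
    have h6 : m ≤ a.count t := by
      by_contra hlt
      push Not at hlt
      have h7 := a.entry_lt_iff ⟨a.count t, hlt.trans hm⟩ t
      have h8 : a.entry ⟨a.count t, hlt.trans hm⟩ < a.entry ⟨m, hm⟩ := a.strictMono hlt
      rw [Fin.lt_def] at h8
      simp only at h7
      omega
    have h7 : a.count (t + 1) ≤ m + 1 := by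
      by_contra hlt
      push Not at hlt
      have hl := a.count_le_len (t + 1)
      have h8 := a.entry_lt_iff ⟨m + 1, by omega⟩ (t + 1)
      have h9 : a.entry ⟨m, hm⟩ < a.entry ⟨m + 1, by omega⟩ := a.strictMono (by simp)
      rw [Fin.lt_def] at h9
      simp only at h8
      omega
    omega

theorem count_mono (a : PluckerIndex n) {s t : ℕ} (h : s ≤ t) : a.count s ≤ a.count t :=
  Finset.card_le_card fun r hr => by
    simp only [Finset.mem_filter, Finset.mem_univ, true_and] at hr ⊢
    omega

theorem count_succ (a : PluckerIndex n) (t : ℕ) :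
    a.count (t + 1) = a.count t ∨ a.count (t + 1) = a.count t + 1 := by
  have h1 := a.count_mono (Nat.le_succ t)
  by_contra hne
  push Not at hne
  simp only [Nat.succ_eq_add_one] at h1
  have h2 : a.count t + 1 < a.count (t + 1) := by omega
  have hl := a.count_le_len (t + 1)
  have h3 := a.entry_lt_iff ⟨a.count t, by omega⟩ t
  have h4 := a.entry_lt_iff ⟨a.count t + 1, by omega⟩ (t + 1)
  have h5 : a.entry ⟨a.count t, by omega⟩ < a.entry ⟨a.count t + 1, by omega⟩ :=
    a.strictMono (by simp)
  rw [Fin.lt_def] at h5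
  simp only at h3 h4
  omega

theorem le_iff_count (a b : PluckerIndex n) : a ≤ b ↔ ∀ t, b.count t ≤ a.count t := by
  rw [le_def]
  constructor
  · rintro ⟨hl, h⟩ t
    by_contra hlt
    push Not at hlt
    have hb := b.count_le_len t
    have h1 := a.entry_lt_iff ⟨a.count t, by omega⟩ t
    have h2 := b.entry_lt_iff ⟨a.count t, by omega⟩ t
    have h3 := h (a.count t) (by omega) (by omega)
    rw [Fin.le_def] at h3
    simp only at h1 h2
    omega
  · intro h
    refine ⟨?_, fun r ha hb => ?_⟩
    · have := h n
      rwa [count_of_le _ le_rfl, count_of_le _ le_rfl] at this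
    · have h1 := a.entry_lt_iff ⟨r, ha⟩ ((b.entry ⟨r, hb⟩).1 + 1)
      have h2 := b.entry_lt_iff ⟨r, hb⟩ ((b.entry ⟨r, hb⟩).1 + 1)
      have h3 := h ((b.entry ⟨r, hb⟩).1 + 1)
      rw [Fin.le_def]
      simp only at h1 h2
      omega

theorem le_iff_count' (a b : PluckerIndex n) : a ≤ b ↔ ∀ t ≤ n, b.count t ≤ a.count t := by
  rw [le_iff_count]
  refine ⟨fun h t _ => h t, fun h t => ?_⟩
  rcases le_total t n with ht | ht
  · exact h t ht
  · rw [count_of_le _ ht, count_of_le _ ht, ← count_of_le a le_rfl, ← count_of_le b le_rfl]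
    exact h n le_rfl

theorem ext_count {a b : PluckerIndex n} (h : ∀ t ≤ n, a.count t = b.count t) : a = b :=
  le_antisymm ((le_iff_count' a b).2 fun t ht => (h t ht).ge)
    ((le_iff_count' b a).2 fun t ht => (h t ht).le)

instance : Finite (PluckerIndex n) := by
  refine Finite.of_injective
    (fun (a : PluckerIndex n) (t : Fin (n + 1)) =>
      (⟨a.count t, Nat.lt_succ_of_le ((a.count_le_len t).trans a.len_lt.le)⟩ : Fin (n + 1)))
    fun a b h => ext_count fun t ht => ?_
  have := congrFun h ⟨t, Nat.lt_succ_of_le ht⟩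
  simpa using this

/-- Every lattice path from `0` with steps `0` and `1` whose end is neither `0` nor `n` comes
from a Plücker index. -/
theorem exists_of_path (h : ℕ → ℕ) (h0 : h 0 = 0)
    (hs : ∀ t < n, h (t + 1) = h t ∨ h (t + 1) = h t + 1) (hpos : 0 < h n) (hlt : h n < n) :
    ∃ a : PluckerIndex n, ∀ t ≤ n, a.count t = h t := by
  classical
  -- The subscripts are the positions of the up-steps.
  let S : Finset (Fin n) := Finset.univ.filter fun i => h (i.1 + 1) = h i.1 + 1
  have hcard : ∀ t ≤ n, (S.filter fun i => i.1 < t).card = h t := by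
    intro t
    induction t with
    | zero => intro _; simp [h0]
    | succ t ih =>
      intro ht
      have ih' := ih (by omega)
      have hsplit : (S.filter fun i => i.1 < t + 1) =
          (S.filter fun i => i.1 < t) ∪ (S.filter fun i => i.1 = t) := by
        ext i
        simp only [Finset.mem_filter, Finset.mem_union]
        constructor
        · rintro ⟨h1, h2⟩
          rcases Nat.lt_succ_iff_lt_or_eq.1 h2 with h3 | h3
          · exact Or.inl ⟨h1, h3⟩
          · exact Or.inr ⟨h1, h3⟩
        · rintro (⟨h1, h2⟩ | ⟨h1, h2⟩)
          · exact ⟨h1, by omega⟩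
          · exact ⟨h1, by omega⟩
      rw [hsplit, Finset.card_union_of_disjoint, ih']
      · rcases hs t (by omega) with h1 | h1
        · have : (S.filter fun i => i.1 = t) = ∅ := by
            ext i
            simp only [S, Finset.mem_filter, Finset.mem_univ, true_and, Finset.notMem_empty,
              iff_false, not_and]
            rintro h2 rfl
            omega
          rw [this, h1]; simp
        · have : (S.filter fun i => i.1 = t) = {⟨t, by omega⟩} := by
            ext i
            simp only [S, Finset.mem_filter, Finset.mem_univ, true_and, Finset.mem_singleton,
              Fin.ext_iff]
            constructor
            · exact fun h2 => h2.2
            · rintro h2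
              exact ⟨by rw [h2]; exact h1, h2⟩
          rw [this, h1]; simp
      · rw [Finset.disjoint_left]
        intro i hi hi'
        simp only [Finset.mem_filter] at hi hi'
        omega
  have hS : S.card = h n := by
    rw [← hcard n le_rfl, Finset.filter_true_of_mem fun i _ => i.2]
  refine ⟨⟨S.card, by omega, by omega, S.orderEmbOfFin rfl, (S.orderEmbOfFin rfl).strictMono⟩,
    fun t ht => ?_⟩
  rw [← hcard t ht]
  unfold count
  simp only
  rw [← Finset.card_map (S.orderEmbOfFin rfl).toEmbedding]
  congr 1
  ext i
  simp only [Finset.mem_map, Finset.mem_filter, Finset.mem_univ, true_and]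
  constructor
  · rintro ⟨r, hr, rfl⟩
    exact ⟨Finset.orderEmbOfFin_mem S rfl r, hr⟩
  · rintro ⟨hi, hit⟩
    have : i ∈ Set.range (S.orderEmbOfFin rfl) := by
      rw [Finset.range_orderEmbOfFin]; exact hi
    obtain ⟨r, rfl⟩ := this
    exact ⟨r, hit, rfl⟩

/-- The maximum of two paths with steps `0` and `1` is again such a path, so it comes from an index,
and the order identifies that index with the meet. -/
theorem count_inf (a b : PluckerIndex n) {t : ℕ} (ht : t ≤ n) :
    (a ⊓ b).count t = max (a.count t) (b.count t) := by
  obtain ⟨g, hg⟩ := exists_of_path (n := n) (fun t => max (a.count t) (b.count t)) (by simp)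
    (fun t _ => by
      have h1 := a.count_succ t
      have h2 := b.count_succ t
      omega)
    (by
      rw [count_of_le a le_rfl]
      exact lt_max_of_lt_left a.len_pos)
    (by
      rw [count_of_le a le_rfl, count_of_le b le_rfl]
      exact max_lt a.len_lt b.len_lt)
  have : a ⊓ b = g := by
    refine le_antisymm ?_ (le_inf ?_ ?_)
    · rw [le_iff_count']
      intro t ht
      rw [hg t ht]
      exact max_le ((le_iff_count _ _).1 inf_le_left t) ((le_iff_count _ _).1 inf_le_right t)
    · rw [le_iff_count']
      intro t ht
      rw [hg t ht]
      exact le_max_left _ _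
    · rw [le_iff_count']
      intro t ht
      rw [hg t ht]
      exact le_max_right _ _
  rw [this, hg t ht]

theorem count_sup (a b : PluckerIndex n) {t : ℕ} (ht : t ≤ n) :
    (a ⊔ b).count t = min (a.count t) (b.count t) := by
  obtain ⟨g, hg⟩ := exists_of_path (n := n) (fun t => min (a.count t) (b.count t)) (by simp)
    (fun t _ => by
      have h1 := a.count_succ t
      have h2 := b.count_succ t
      omega)
    (by
      rw [count_of_le a le_rfl, count_of_le b le_rfl]
      exact lt_min a.len_pos b.len_pos)
    (by
      rw [count_of_le a le_rfl]
      exact min_lt_of_left_lt a.len_lt)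
  have : a ⊔ b = g := by
    refine le_antisymm (sup_le ?_ ?_) ?_
    · rw [le_iff_count']
      intro t ht
      rw [hg t ht]
      exact min_le_left _ _
    · rw [le_iff_count']
      intro t ht
      rw [hg t ht]
      exact min_le_right _ _
    · rw [le_iff_count']
      intro t ht
      rw [hg t ht]
      exact le_min ((le_iff_count _ _).1 le_sup_left t) ((le_iff_count _ _).1 le_sup_right t)
  rw [this, hg t ht]

/-! ### Raising a path at one place, and the rigidity of intervals. -/

/-- `e` arises from `a` by raising the path of `a` by one at the single place `t`. -/
def IsRaise (a e : PluckerIndex n) (t : ℕ) : Prop :=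
  0 < t ∧ t ≤ n ∧ e.count t = a.count t + 1 ∧ ∀ s ≤ n, s ≠ t → e.count s = a.count s

/-- A corner, with a flat step in and an up-step out, can be flipped. At `t = n` there is no
outgoing step, and the raised end only has to stay below `n`. -/
theorem exists_isRaise (a : PluckerIndex n) {t : ℕ} (h0 : 0 < t) (ht : t ≤ n)
    (h1 : a.count t = a.count (t - 1)) (h2 : t < n → a.count (t + 1) = a.count t + 1)
    (h3 : t = n → a.count n + 1 < n) : ∃ e, IsRaise a e t := by
  have hl := a.count_of_le le_rfl
  have hp := a.len_pos
  have hp' := a.len_lt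
  obtain ⟨e, he⟩ := exists_of_path (n := n) (fun s => if s = t then a.count s + 1 else a.count s)
    (by simp [h0.ne])
    (fun s hs => by
      have h4 := a.count_succ s
      rcases eq_or_ne s t with rfl | hst
      · have := h2 hs
        simp; omega
      · rcases eq_or_ne (s + 1) t with rfl | hst'
        · simp at h1 ⊢; omega
        · simp [hst, hst', h4])
    (by split_ifs <;> omega)
    (by
      split_ifs with h
      · exact h3 h.symm
      · omega)
  refine ⟨e, h0, ht, ?_, fun s hs hst => ?_⟩
  · rw [he t ht]; simp
  · rw [he s hs]; simp [hst]

/-- A raise below a given upper bound, to the left of an up-step. -/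
theorem exists_isRaise_left {a c : PluckerIndex n} (y : ℕ) (hy : y < n)
    (hgt : a.count y < c.count y) (hstep : a.count (y + 1) = a.count y + 1) :
    ∃ t ≤ y, a.count t < c.count t ∧ ∃ e, IsRaise a e t := by
  induction y with
  | zero => simp at hgt
  | succ y ih =>
    rcases a.count_succ y with h | h
    · exact ⟨y + 1, le_rfl, hgt, a.exists_isRaise (by omega) (by omega) (by simpa using h)
        (fun _ => hstep) (fun h => by omega)⟩
    -- An up-step enters `y + 1` and `c` rises by at most one there, so `a` is below `c` at `y` too
    -- and the search moves left; it stops because both paths start at `0`.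
    · have hc := c.count_succ y
      obtain ⟨t, ht, h'⟩ := ih (by omega) (by omega) h
      exact ⟨t, by omega, h'⟩

/-- A raise below a given upper bound, to the right of a flat step. -/
theorem exists_isRaise_right {a c : PluckerIndex n} (k y : ℕ) (hk : y + k = n)
    (hgt : a.count y < c.count y) (hstep : a.count y = a.count (y - 1)) :
    ∃ t, y ≤ t ∧ t ≤ n ∧ a.count t < c.count t ∧ ∃ e, IsRaise a e t := by
  have hy0 : 0 < y := by
    rcases Nat.eq_zero_or_pos y with rfl | h
    · simp at hgt
    · exact h
  induction k generalizing y with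
  | zero =>
    refine ⟨y, le_rfl, by omega, hgt, a.exists_isRaise hy0 (by omega) hstep
      (fun h => by omega) (fun h => ?_)⟩
    have h1 := c.count_le_len y
    have h2 := c.len_lt
    subst h
    omega
  | succ k ih =>
    rcases a.count_succ y with h | h
    · have hc := c.count_mono (Nat.le_succ y)
      simp only [Nat.succ_eq_add_one] at hc
      obtain ⟨t, ht, h'⟩ := ih (y + 1) (by omega) (by omega) (by simpa using h) (by omega)
      exact ⟨t, by omega, h'⟩
    · exact ⟨y, le_rfl, by omega, hgt, a.exists_isRaise hy0 (by omega) hstep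
        (fun _ => h) (fun h => by omega)⟩

theorem exists_isRaise_of_lt {a c : PluckerIndex n} {y : ℕ} (hy : y ≤ n)
    (hgt : a.count y < c.count y) :
    ∃ t ≤ n, a.count t < c.count t ∧ ∃ e, IsRaise a e t := by
  obtain ⟨x, rfl⟩ : ∃ x, y = x + 1 := by
    rcases y with _ | x
    · simp at hgt
    · exact ⟨x, rfl⟩
  rcases a.count_succ x with h | h
  · obtain ⟨t, -, h1, h2⟩ := exists_isRaise_right (c := c) (n - (x + 1)) (x + 1) (by omega) hgt
      (by simpa using h)
    exact ⟨t, h1, h2⟩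
  · have hc := c.count_succ x
    obtain ⟨t, h1, h2⟩ := exists_isRaise_left (c := c) x (by omega) (by omega) h
    exact ⟨t, by omega, h2⟩

/-- If every raise of `a` below `c` is comparable to `b`, then the paths of `a` below `c` and of
`b` have a rigid shape. -/
theorem raise_rigid {a b c : PluckerIndex n} (hca : c ≤ a) (hcb : c ≤ b) (hab : ¬ a ≤ b)
    (hba : ¬ b ≤ a)
    (H : ∀ e, c ≤ e → e ≤ a → e ≠ a → b ≤ e ∨ e ≤ b) :
    ∃ p, 0 < p ∧ p ≤ n ∧ b.count p = a.count p + 1 ∧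
      (∀ t ≤ n, t ≠ p → b.count t ≤ a.count t) ∧
      a.count p = a.count (p - 1) ∧ (p < n → a.count (p + 1) = a.count p + 1) ∧
      ∀ y ≤ n, a.count y < c.count y →
        (a.count y = a.count (y - 1) → y ≤ p) ∧
        (a.count y = a.count (y - 1) + 1 → p < y) ∧
        (y < n → a.count (y + 1) = a.count y + 1 → p ≤ y) ∧
        (y < n → a.count (y + 1) = a.count y → y < p) := by
  have hlt : ∃ y ≤ n, b.count y < a.count y := by
    by_contra hcon
    push Not at hcon
    exact hba ((le_iff_count' _ _).2 hcon)
  have hlt' : ∃ y ≤ n, a.count y < b.count y := by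
    by_contra hcon
    push Not at hcon
    exact hab ((le_iff_count' _ _).2 hcon)
  -- The raise lies in `[c, a]`, hence is comparable to `b`. Since `b ≤ e` would give `b ≤ a`, it
  -- follows that `e ≤ b`, so the path of `b` can exceed that of `a` only at `t`, and by at most
  -- one.
  have key : ∀ t e, a.count t < c.count t → IsRaise a e t →
      (∀ s ≤ n, s ≠ t → b.count s ≤ a.count s) ∧ b.count t ≤ a.count t + 1 := by
    intro t e htc he
    obtain ⟨h0, htn, h1, h2⟩ := he
    have hce : c ≤ e := by
      rw [le_iff_count']
      intro s hs
      have h3 := (le_iff_count _ _).1 hca s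
      rcases eq_or_ne s t with rfl | hst
      · omega
      · rw [h2 s hs hst]; exact h3
    have hea : e ≤ a := by
      rw [le_iff_count']
      intro s hs
      rcases eq_or_ne s t with rfl | hst
      · omega
      · rw [h2 s hs hst]
    have hne : e ≠ a := by
      rintro rfl
      omega
    rcases H e hce hea hne with h | h
    · exfalso
      obtain ⟨y, hy, hyl⟩ := hlt
      have h3 := (le_iff_count _ _).1 h y
      have h4 := (le_iff_count _ _).1 hea y
      omega
    · rw [le_iff_count] at h
      refine ⟨fun s hs hst => ?_, ?_⟩
      · rw [← h2 s hs hst]; exact h s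
      · have := h t; omega
  obtain ⟨y, hy, hyl⟩ := hlt'
  have hyc := (le_iff_count _ _).1 hcb y
  obtain ⟨p, hpn, hpc, e, he⟩ := exists_isRaise_of_lt hy (hyl.trans_le hyc)
  have hkp := key p e hpc he
  have hyp : y = p := by
    by_contra hne
    have := hkp.1 y hy hne
    omega
  subst hyp
  -- Below `c`, the path of `a` can be raised only at the one place where `b` exceeds `a`.
  have huniq : ∀ t e', a.count t < c.count t → IsRaise a e' t → t = y := by
    intro t e' ht he'
    by_contra hne
    have := (key t e' ht he').1 y hy (Ne.symm hne)
    omega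
  have he2 := he.2.2
  have hflat : a.count y = a.count (y - 1) := by
    obtain ⟨h0, h1, h2, h3⟩ := he
    obtain ⟨x, rfl⟩ : ∃ x, y = x + 1 := ⟨y - 1, by omega⟩
    have h4 := h3 x (by omega) (by omega)
    have h5 := e.count_succ x
    have h6 := a.count_succ x
    simp
    omega
  have hup : y < n → a.count (y + 1) = a.count y + 1 := by
    intro hyn
    obtain ⟨h0, h1, h2, h3⟩ := he
    have h4 := h3 (y + 1) (by omega) (by omega)
    have h5 := e.count_succ y
    have h6 := a.count_succ y
    omega
  -- Each kind of step next to `x` produces a raise on a known side of `x`; by uniqueness this raise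
  -- sits at `y`.
  refine ⟨y, he.1, hy, by omega, hkp.1, hflat, hup, fun x hx hxc => ⟨fun h => ?_, fun h => ?_,
    fun hxn h => ?_, fun hxn h => ?_⟩⟩
  · obtain ⟨t, h1, -, h2, e', h3⟩ := exists_isRaise_right (c := c) (n - x) x (by omega) hxc h
    rw [← huniq t e' h2 h3]; exact h1
  · obtain ⟨z, rfl⟩ : ∃ z, x = z + 1 := by
      rcases x with _ | z
      · simp at hxc
      · exact ⟨z, rfl⟩
    have hc := c.count_succ z
    simp only [Nat.add_sub_cancel] at h
    obtain ⟨t, h1, h2, e', h3⟩ := exists_isRaise_left (c := c) z (by omega) (by omega) h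
    have := huniq t e' h2 h3
    omega
  · obtain ⟨t, h1, h2, e', h3⟩ := exists_isRaise_left (c := c) x hxn hxc h
    have := huniq t e' h2 h3
    omega
  · have hc := c.count_mono (Nat.le_succ x)
    simp only [Nat.succ_eq_add_one] at hc
    obtain ⟨t, h1, -, h2, e', h3⟩ := exists_isRaise_right (a := a) (c := c) (n - (x + 1)) (x + 1) (by omega)
      (by omega) (by simpa using h)
    have := huniq t e' h2 h3
    omega


/-- A place `y` where `c` is above both paths must lie strictly between `p` and `q`. There `a` steps
up into and out of `y`, while `b` is flat on both sides. As the two paths agree off `p` and `q`, the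
neighbours of `y` are `p` and `q`. -/
theorem path_rigid_aux {a b c : PluckerIndex n} {p q : ℕ} (hca : c ≤ a) (hcb : c ≤ b)
    (hcn : c.count n = max (a.count n) (b.count n)) (hpq : p < q) (hp0 : 0 < p) (hqn : q ≤ n)
    (hbp : b.count p = a.count p + 1) (haq : a.count q = b.count q + 1)
    (hne : ∀ t ≤ n, t ≠ p → t ≠ q → a.count t = b.count t)
    (ha : ∀ y ≤ n, a.count y < c.count y →
        (a.count y = a.count (y - 1) → y ≤ p) ∧
        (a.count y = a.count (y - 1) + 1 → p < y) ∧
        (y < n → a.count (y + 1) = a.count y + 1 → p ≤ y) ∧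
        (y < n → a.count (y + 1) = a.count y → y < p))
    (hb : ∀ y ≤ n, b.count y < c.count y →
        (b.count y = b.count (y - 1) → y ≤ q) ∧
        (b.count y = b.count (y - 1) + 1 → q < y) ∧
        (y < n → b.count (y + 1) = b.count y + 1 → q ≤ y) ∧
        (y < n → b.count (y + 1) = b.count y → y < q))
    (hbq : q < n → b.count (q + 1) = b.count q + 1) (hap : a.count p = a.count (p - 1))
    {y : ℕ} (hy : y ≤ n) (hya : a.count y < c.count y) (hyb : b.count y < c.count y) :
    y = p + 1 ∧ q = p + 2 ∧ c.count y = a.count y + 1 := by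
  have hstep : ∀ (x : PluckerIndex n) (t : ℕ), 0 < t →
      x.count t = x.count (t - 1) ∨ x.count t = x.count (t - 1) + 1 := by
    intro x t ht
    obtain ⟨s, rfl⟩ : ∃ s, t = s + 1 := ⟨t - 1, by omega⟩
    simpa using x.count_succ s
  -- Left of `q`, the path of `b` is flat after any place where it is below `c`, so being below `c`
  -- would persist up to `p`, where `b` steps up.
  have hpy : p < y := by
    by_contra hyp
    push Not at hyp
    have hright : ∀ k, y + k ≤ p → b.count (y + k) < c.count (y + k) := by
      intro k
      induction k with
      | zero => intro _; exact hyb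
      | succ k ih =>
        intro hk
        have h1 := ih (by omega)
        have h2 := (hb (y + k) (by omega) h1).2.2.1 (by omega)
        have h3 := b.count_succ (y + k)
        have h4 := c.count_mono (Nat.le_succ (y + k))
        simp only [Nat.succ_eq_add_one] at h4
        rw [← add_assoc]
        omega
    have h1 := hright (p - y) (by omega)
    rw [Nat.add_sub_cancel' hyp] at h1
    have h2 := (hb p (by omega) h1).2.1
    have h3 := hne (p - 1) (by omega) (by omega) (by omega)
    omega
  -- Right of `p`, the path of `a` steps up into any place where it is below `c`, so being below `c`
  -- would persist leftwards to `q`. There it contradicts the agreement at `q + 1`, or `hcn` if `q =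
  -- n`.
  have hgq : ∀ z ≤ n, q ≤ z → ¬ (a.count z < c.count z) := by
    intro z hz hqz hlt
    have hleft : ∀ k, k ≤ z - q → a.count (z - k) < c.count (z - k) := by
      intro k
      induction k with
      | zero => intro _; exact hlt
      | succ k ih =>
        intro hk
        have h1 := ih (by omega)
        have h2 := (ha (z - k) (by omega) h1).1
        have h3 := hstep a (z - k) (by omega)
        have h4 := hstep c (z - k) (by omega)
        rw [show z - (k + 1) = z - k - 1 by omega]
        omega
    have h1 := hleft (z - q) le_rfl
    rw [show z - (z - q) = q by omega] at h1
    rcases Nat.lt_or_ge q n with h2 | h2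
    · have h3 := (ha q hqn h1).2.2.2 h2
      have h4 := hne (q + 1) (by omega) (by omega) (by omega)
      have h5 := hbq h2
      omega
    · obtain rfl : q = n := by omega
      omega
  have hyq : y < q := by
    by_contra h
    exact hgq y hy (by omega) hya
  have h1 := (ha y hy hya)
  have h2 := (hb y hy hyb)
  have h3 := hne y hy (by omega) (by omega)
  have h4 := hstep a y (by omega)
  have h5 := hstep b y (by omega)
  have h6 := a.count_succ y
  have h7 := b.count_succ y
  have e1 : y = p + 1 := by
    by_contra hcon
    have := hne (y - 1) (by omega) (by omega) (by omega)
    omega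
  have e2 : q = y + 1 := by
    by_contra hcon
    have := hne (y + 1) (by omega) (by omega) (by omega)
    omega
  refine ⟨e1, by omega, ?_⟩
  have h8 := hgq q hqn le_rfl
  have h9 := c.count_mono (Nat.le_succ y)
  simp only [Nat.succ_eq_add_one] at h9
  rw [e2] at h8
  omega

/-- If every element of the interval `[c, d]` other than `a` and `b` is comparable to both of the
incomparable elements `a` and `b`, then the path of `c` exceeds that of `a ⊓ b` by one at a
single common point of the paths of `a` and `b`, if at all. -/
theorem interval_rigid {a b c d : PluckerIndex n} (hab : ¬ a ≤ b) (hba : ¬ b ≤ a)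
    (hca : c ≤ a) (hcb : c ≤ b) (had : a ≤ d) (hbd : b ≤ d)
    (hcn : c.count n = max (a.count n) (b.count n))
    (H : ∀ e, c ≤ e → e ≤ d → e ≠ a → e ≠ b → (a ≤ e ∨ e ≤ a) ∧ (b ≤ e ∨ e ≤ b))
    {y : ℕ} (hy : y ≤ n) (hya : a.count y < c.count y) (hyb : b.count y < c.count y) :
    y < n ∧ a.count y = b.count y ∧ c.count y = a.count y + 1 ∧
      ∀ t ≤ n, t ≠ y → c.count t = max (a.count t) (b.count t) := by
  obtain ⟨p, hp0, hpn, hp1, hp2, hp3, hp4, hp5⟩ := raise_rigid hca hcb hab hba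
    fun e h1 h2 h3 => (H e h1 (h2.trans had) h3 fun h => hba (h ▸ h2)).2
  obtain ⟨q, hq0, hqn, hq1, hq2, hq3, hq4, hq5⟩ := raise_rigid hcb hca hba hab
    fun e h1 h2 h3 => (H e h1 (h2.trans hbd) (fun h => hab (h ▸ h2)) h3).1
  have hpq : p ≠ q := by
    rintro rfl
    omega
  have hne : ∀ t ≤ n, t ≠ p → t ≠ q → a.count t = b.count t := fun t ht h1 h2 =>
    le_antisymm (hq2 t ht h2) (hp2 t ht h1)
  have key : ∀ z ≤ n, a.count z < c.count z → b.count z < c.count z →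
      z = min p q + 1 ∧ max p q = min p q + 2 ∧
        c.count z = max (a.count z) (b.count z) + 1 := by
    intro z hz hza hzb
    rcases lt_or_gt_of_ne hpq with h | h
    · obtain ⟨h1, h2, h3⟩ := path_rigid_aux hca hcb hcn h hp0 hqn hp1 hq1 hne hp5 hq5 hq4 hp3
        hz hza hzb
      have := hne z hz (by omega) (by omega)
      omega
    · obtain ⟨h1, h2, h3⟩ := path_rigid_aux hcb hca (by rw [hcn, max_comm]) h hq0 hpn hq1 hp1
        (fun t ht h1 h2 => (hne t ht h2 h1).symm) hq5 hp5 hp4 hq3 hz hzb hza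
      have := hne z hz (by omega) (by omega)
      omega
  obtain ⟨h1, h2, h3⟩ := key y hy hya hyb
  have h4 := hne y hy (by omega) (by omega)
  refine ⟨by omega, h4, by omega, fun t ht hty => ?_⟩
  have h5 := (le_iff_count _ _).1 hca t
  have h6 := (le_iff_count _ _).1 hcb t
  by_contra hcon
  have := key t ht (by omega) (by omega)
  omega

end PluckerIndex

/-! ### Valuations on the lattice of Plücker indices -/

namespace PluckerIndex

variable {n : ℕ}

/-- The sum over the points of the path of `a` of values prescribed by `G`. -/
noncomputable def pathWeight (G : ℕ → ℕ → ℝ) (a : PluckerIndex n) : ℝ :=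
  ∑ t ∈ Finset.range n, G t (a.count (t + 1))

theorem pathWeight_inf_add_sup (G : ℕ → ℕ → ℝ) (a b : PluckerIndex n) :
    pathWeight G (a ⊓ b) + pathWeight G (a ⊔ b) = pathWeight G a + pathWeight G b := by
  unfold pathWeight
  rw [← Finset.sum_add_distrib, ← Finset.sum_add_distrib]
  refine Finset.sum_congr rfl fun t ht => ?_
  have ht' := Finset.mem_range.1 ht
  rw [count_inf a b (by omega), count_sup a b (by omega)]
  rcases le_total (a.count (t + 1)) (b.count (t + 1)) with h | h
  · rw [max_eq_right h, min_eq_left h, add_comm]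
  · rw [max_eq_left h, min_eq_right h]

theorem IsRaise.inf {a e a' e' : PluckerIndex n} {t : ℕ} (h : IsRaise a e t)
    (h' : IsRaise a' e' t) : IsRaise (a ⊓ a') (e ⊓ e') t := by
  obtain ⟨h0, ht, h1, h2⟩ := h
  obtain ⟨-, -, h1', h2'⟩ := h'
  refine ⟨h0, ht, ?_, fun s hs hst => ?_⟩
  · rw [count_inf _ _ ht, count_inf _ _ ht, h1, h1']
    omega
  · rw [count_inf _ _ hs, count_inf _ _ hs, h2 s hs hst, h2' s hs hst]

theorem IsRaise.inf_eq_of_le {a e a' e' : PluckerIndex n} {t : ℕ} (h : IsRaise a e t)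
    (h' : IsRaise a' e' t) (hc : a.count t = a'.count t) (hle : a' ≤ a) :
    e ⊓ a' = e' ∧ e ⊔ a' = a := by
  obtain ⟨h0, ht, h1, h2⟩ := h
  obtain ⟨-, -, h1', h2'⟩ := h'
  rw [le_iff_count] at hle
  constructor
  · refine ext_count fun s hs => ?_
    have h3 := hle s
    rw [count_inf _ _ hs]
    rcases eq_or_ne s t with rfl | hst
    · omega
    · rw [h2 s hs hst, h2' s hs hst]
      omega
  · refine ext_count fun s hs => ?_
    have h3 := hle s
    rw [count_sup _ _ hs]
    rcases eq_or_ne s t with rfl | hst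
    · omega
    · rw [h2 s hs hst]
      omega

/-- Both raises are compared with the raise of `a ⊓ a'` at the same place, through one lattice
square each. So the increment of a valuation depends only on the place and the height of the raise.
-/
theorem raise_sub_eq {w : PluckerIndex n → ℝ} (hw : ∀ a b, w a + w b = w (a ⊓ b) + w (a ⊔ b))
    {a e a' e' : PluckerIndex n} {t : ℕ} (h : IsRaise a e t) (h' : IsRaise a' e' t)
    (hc : a.count t = a'.count t) : w e - w a = w e' - w a' := by
  have hi := h.inf h'
  have hci : (a ⊓ a').count t = a.count t := by
    rw [count_inf _ _ h.2.1, hc, max_self]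
  obtain ⟨h1, h2⟩ := h.inf_eq_of_le hi hci.symm inf_le_left
  obtain ⟨h3, h4⟩ := h'.inf_eq_of_le hi (hci.trans hc).symm inf_le_right
  have h5 := hw e (a ⊓ a')
  have h6 := hw e' (a ⊓ a')
  rw [h1, h2] at h5
  rw [h3, h4] at h6
  linarith

/-- Raises lead from `a` and from `b` to `a ⊓ b`: each one decreases the area between the current
path and that of the meet. -/
theorem eq_of_raise_invariant {u : PluckerIndex n → ℝ}
    (hu : ∀ a e t, IsRaise a e t → u e = u a) (a b : PluckerIndex n) : u a = u b := by
  have key : ∀ k : ℕ, ∀ a c : PluckerIndex n, c ≤ a →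
      ∑ t ∈ Finset.range (n + 1), (c.count t - a.count t) ≤ k → u c = u a := by
    intro k
    induction k with
    | zero =>
      intro a c hca hk
      have hk' := Nat.le_zero.1 hk
      rw [Finset.sum_eq_zero_iff] at hk'
      refine congrArg u (ext_count fun t ht => ?_)
      have h1 := hk' t (Finset.mem_range.2 (by omega))
      have h2 := (le_iff_count _ _).1 hca t
      omega
    | succ k ih =>
      intro a c hca hk
      by_cases hex : ∃ y ≤ n, a.count y < c.count y
      · obtain ⟨y, hy, hyl⟩ := hex
        obtain ⟨t, ht, htl, e, he⟩ := exists_isRaise_of_lt hy hyl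
        rw [← hu a e t he]
        have he' := he
        obtain ⟨h0, -, h1, h2⟩ := he'
        have hce : c ≤ e := by
          rw [le_iff_count']
          intro s hs
          have h3 := (le_iff_count _ _).1 hca s
          rcases eq_or_ne s t with rfl | hst
          · omega
          · rw [h2 s hs hst]; exact h3
        refine ih e c hce ?_
        have hlt : ∑ s ∈ Finset.range (n + 1), (c.count s - e.count s) <
            ∑ s ∈ Finset.range (n + 1), (c.count s - a.count s) := by
          refine Finset.sum_lt_sum (fun s hs => ?_) ⟨t, Finset.mem_range.2 (by omega), by omega⟩
          have hs' := Finset.mem_range.1 hs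
          rcases eq_or_ne s t with rfl | hst
          · omega
          · rw [h2 s (by omega) hst]
        omega
      · push Not at hex
        rw [ext_count fun t ht => le_antisymm (hex t ht) ((le_iff_count _ _).1 hca t)]
  rw [← key _ a (a ⊓ b) inf_le_left le_rfl, key _ b (a ⊓ b) inf_le_right le_rfl]

/-- Every valuation on the lattice of Plücker indices is a path weight. -/
theorem exists_pathWeight_eq {w : PluckerIndex n → ℝ}
    (hw : ∀ a b, w a + w b = w (a ⊓ b) + w (a ⊔ b)) : ∃ G, w = pathWeight G := by
  classical
  rcases isEmpty_or_nonempty (PluckerIndex n) with hemp | ⟨⟨a₀⟩⟩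
  · exact ⟨0, funext fun a => hemp.elim a⟩
  have hg : ∀ t m : ℕ, ∃ x : ℝ, ∀ a e : PluckerIndex n, IsRaise a e (t + 1) →
      a.count (t + 1) = m → w e - w a = x := by
    intro t m
    by_cases hex : ∃ a e : PluckerIndex n, IsRaise a e (t + 1) ∧ a.count (t + 1) = m
    · obtain ⟨a, e, h, hm⟩ := hex
      exact ⟨w e - w a, fun a' e' h' hm' => raise_sub_eq hw h' h (hm'.trans hm.symm)⟩
    · push Not at hex
      exact ⟨0, fun a e h hm => absurd hm (hex a e h)⟩
  choose g hg using hg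
  let G : ℕ → ℕ → ℝ := fun t m => ∑ j ∈ Finset.range m, g t j
  have hG : ∀ (a e : PluckerIndex n) (t : ℕ), IsRaise a e t →
      w e - pathWeight G e = w a - pathWeight G a := by
    intro a e t h
    have h' := h
    obtain ⟨h0, ht, h1, h2⟩ := h'
    obtain ⟨s, rfl⟩ : ∃ s, t = s + 1 := ⟨t - 1, by omega⟩
    have hdiff : pathWeight G e - pathWeight G a = g s (a.count (s + 1)) := by
      unfold pathWeight
      rw [← Finset.sum_sub_distrib, Finset.sum_eq_single s]
      · rw [h1]
        simp [G, Finset.sum_range_succ]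
      · intro r hr hrs
        have := Finset.mem_range.1 hr
        rw [h2 (r + 1) (by omega) (by omega), sub_self]
      · intro hs
        exact absurd (Finset.mem_range.2 (by omega)) hs
    have := hg s _ a e h rfl
    linarith
  have hconst := fun a => eq_of_raise_invariant (u := fun a => w a - pathWeight G a) hG a a₀
  -- The leftover constant is absorbed by the summand `t = 0`, which is present because `n > 0`.
  refine ⟨fun t m => G t m + if t = 0 then w a₀ - pathWeight G a₀ else 0, funext fun a => ?_⟩
  have hn : 0 < n := a₀.len_pos.trans a₀.len_lt
  have h1 := hconst a
  unfold pathWeight at h1 ⊢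
  rw [Finset.sum_add_distrib, Finset.sum_ite_eq' (Finset.range n) 0, if_pos (Finset.mem_range.2 hn)]
  linarith

end PluckerIndex

/-! ### Minors and their diagonal terms -/

open MvPolynomial in
/-- `E` is the unique exponent of least `f`-weight in `g`, and its coefficient is one. -/
def HasLead {τ : Type*} (f : τ → ℝ) (g : MvPolynomial τ ℂ) (E : τ →₀ ℕ) : Prop :=
  open Classical in
  ∀ D, Finsupp.weight f D ≤ Finsupp.weight f E → coeff D g = if D = E then 1 else 0

namespace HasLead

open MvPolynomial

variable {τ : Type*} {f : τ → ℝ}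

theorem one : HasLead f (1 : MvPolynomial τ ℂ) 0 := by
  classical
  intro D _
  rw [coeff_one]
  simp only [eq_comm]

/-- If `A + B` weighs at most `E + E'`, then `A` weighs at most `E` or `B` weighs less than `E'`;
only the pair `(E, E')` can contribute. -/
theorem mul {g h : MvPolynomial τ ℂ} {E E' : τ →₀ ℕ} (hg : HasLead f g E)
    (hh : HasLead f h E') : HasLead f (g * h) (E + E') := by
  classical
  intro D hD
  have hterm : ∀ x ∈ Finset.HasAntidiagonal.antidiagonal D, coeff x.1 g * coeff x.2 h =
      if x = (E, E') then 1 else 0 := by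
    rintro ⟨A, B⟩ hx
    rw [Finset.HasAntidiagonal.mem_antidiagonal] at hx
    simp only at hx
    subst hx
    rw [map_add, map_add] at hD
    rcases le_or_gt (Finsupp.weight f A) (Finsupp.weight f E) with hA | hA
    · rw [hg A hA]
      by_cases hAE : A = E
      · subst hAE
        rw [hh B (by linarith)]
        simp
      · simp [hAE]
    · rw [hh B (by linarith)]
      have : B ≠ E' := by
        rintro rfl
        linarith
      simp [this]
  rw [coeff_mul, Finset.sum_congr rfl hterm, Finset.sum_ite_eq' (Finset.HasAntidiagonal.antidiagonal D) (E, E')]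
  simp only [Finset.HasAntidiagonal.mem_antidiagonal, eq_comm]

theorem pow {g : MvPolynomial τ ℂ} {E : τ →₀ ℕ} (hg : HasLead f g E) (k : ℕ) :
    HasLead f (g ^ k) (k • E) := by
  induction k with
  | zero => simpa using one
  | succ k ih => rw [pow_succ, succ_nsmul]; exact ih.mul hg

theorem prod {ι : Type*} (s : Finset ι) {g : ι → MvPolynomial τ ℂ} {E : ι → τ →₀ ℕ}
    (hg : ∀ i, HasLead f (g i) (E i)) : HasLead f (∏ i ∈ s, g i) (∑ i ∈ s, E i) := by
  classical
  induction s using Finset.induction_on with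
  | empty => simpa using one
  | insert i s hi ih =>
    rw [Finset.prod_insert hi, Finset.sum_insert hi]
    exact (hg i).mul ih

end HasLead

/-- The identity is the only permutation of least cost for a strictly submodular cost array. -/
theorem sum_lt_sum_perm {k : ℕ} (F : Fin k → Fin k → ℝ)
    (hF : ∀ r r' s s', r < r' → s < s' → F r s + F r' s' < F r s' + F r' s)
    (π : Equiv.Perm (Fin k)) (hπ : π ≠ 1) : ∑ s, F s s < ∑ s, F (π s) s := by
  -- Exchanging two inverted values lowers the cost, so a minimiser is strictly increasing and hence
  -- the identity.
  have key : ∀ π : Equiv.Perm (Fin k), (∀ π' : Equiv.Perm (Fin k),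
      ∑ s, F (π s) s ≤ ∑ s, F (π' s) s) → π = 1 := by
    intro π hmin
    by_contra hne
    have hmono : ¬ StrictMono π := by
      intro hm
      refine hne (Equiv.ext fun x => ?_)
      have := (hm.range_inj (strictMono_id (α := Fin k))).1 (by simp)
      simpa using congrFun this x
    simp only [StrictMono, not_forall, not_lt] at hmono
    obtain ⟨s, s', hs, hle⟩ := hmono
    have hlt : π s' < π s := lt_of_le_of_ne hle fun h => hs.ne' (π.injective h)
    have h1 := hmin (π * Equiv.swap s s')
    have h2 : ∑ x, (F (π x) x - F ((π * Equiv.swap s s') x) x) =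
        (F (π s) s - F ((π * Equiv.swap s s') s) s) +
          (F (π s') s' - F ((π * Equiv.swap s s') s') s') :=
      Fintype.sum_eq_add s s' hs.ne fun x hx => by
        rw [Equiv.Perm.mul_apply, Equiv.swap_apply_of_ne_of_ne hx.1 hx.2, sub_self]
    rw [Finset.sum_sub_distrib] at h2
    simp only [Equiv.Perm.mul_apply, Equiv.swap_apply_left, Equiv.swap_apply_right] at h1 h2
    have h3 := hF _ _ _ _ hlt hs
    linarith
  obtain ⟨π₀, -, hπ₀⟩ := Finset.exists_min_image (Finset.univ : Finset (Equiv.Perm (Fin k)))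
    (fun π => ∑ s, F (π s) s) Finset.univ_nonempty
  have h0 := key π₀ fun π' => hπ₀ π' (Finset.mem_univ _)
  subst h0
  by_contra hlt
  push Not at hlt
  exact hπ (key π fun π' => hlt.trans (by simpa using hπ₀ π' (Finset.mem_univ _)))

namespace PluckerIndex

open MvPolynomial

variable {n : ℕ}

/-- The minor in the first rows and in the columns given by `a`. -/
noncomputable def minor (a : PluckerIndex n) : MvPolynomial (Fin n × Fin n) ℂ :=
  Matrix.det (Matrix.of fun r s : Fin a.len =>
    (X (Fin.castLE a.len_lt.le r, a.entry s) : MvPolynomial (Fin n × Fin n) ℂ))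

theorem mem_pluckerIdeal {p : MvPolynomial (PluckerIndex n) ℂ} :
    p ∈ pluckerIdeal n ↔ aeval minor p = 0 := Iff.rfl

/-- The exponent of the term of `minor a` which belongs to a permutation. -/
noncomputable def permExp (a : PluckerIndex n) (π : Equiv.Perm (Fin a.len)) :
    Fin n × Fin n →₀ ℕ :=
  ∑ s, Finsupp.single (Fin.castLE a.len_lt.le (π s), a.entry s) 1

/-- The exponent of the diagonal term of `minor a`. -/
noncomputable def diagExp (a : PluckerIndex n) : Fin n × Fin n →₀ ℕ := permExp a 1

theorem minor_eq (a : PluckerIndex n) :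
    minor a = ∑ π : Equiv.Perm (Fin a.len),
      monomial (permExp a π) ((Equiv.Perm.sign π : ℤ) : ℂ) := by
  rw [minor, Matrix.det_apply]
  refine Finset.sum_congr rfl fun π _ => ?_
  have h1 : ∏ i, (X (Fin.castLE a.len_lt.le (π i), a.entry i) :
      MvPolynomial (Fin n × Fin n) ℂ) = monomial (permExp a π) 1 := by
    rw [permExp, monomial_sum_one]
    rfl
  simp only [Matrix.of_apply]
  rw [h1, Units.smul_def, ← Int.cast_smul_eq_zsmul ℂ, smul_monomial, smul_eq_mul, mul_one]

/-- The bidegree of a matrix entry, recording its row and its column. -/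
def entryDegree (p : Fin n × Fin n) : (Fin n → ℕ) × (Fin n → ℕ) :=
  (Pi.single p.1 1, Pi.single p.2 1)

/-- The bidegree of the minor given by `a`. -/
noncomputable def bidegree (a : PluckerIndex n) : (Fin n → ℕ) × (Fin n → ℕ) :=
  Finsupp.weight entryDegree (diagExp a)

theorem weight_permExp {M : Type*} [AddCommMonoid M] (v : Fin n × Fin n → M)
    (a : PluckerIndex n) (π : Equiv.Perm (Fin a.len)) :
    Finsupp.weight v (permExp a π) = ∑ s, v (Fin.castLE a.len_lt.le (π s), a.entry s) := by
  simp [permExp, map_sum, Finsupp.weight_single]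

theorem bidegree_permExp (a : PluckerIndex n) (π : Equiv.Perm (Fin a.len)) :
    Finsupp.weight entryDegree (permExp a π) = bidegree a := by
  rw [bidegree, diagExp, weight_permExp, weight_permExp]
  refine Prod.ext ?_ ?_
  · rw [Prod.fst_sum, Prod.fst_sum]
    exact Equiv.sum_comp π fun s => (Pi.single (Fin.castLE a.len_lt.le s) 1 : Fin n → ℕ)
  · rw [Prod.snd_sum, Prod.snd_sum]
    rfl

theorem isWeightedHomogeneous_minor (a : PluckerIndex n) :
    IsWeightedHomogeneous entryDegree (minor a) (bidegree a) := by
  rw [minor_eq]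
  exact IsWeightedHomogeneous.sum _ _ _ fun π _ =>
    isWeightedHomogeneous_monomial _ _ _ (bidegree_permExp a π)

theorem isWeightedHomogeneous_aeval_monomial (m : PluckerIndex n →₀ ℕ) (c : ℂ) :
    IsWeightedHomogeneous entryDegree (aeval minor (monomial m c))
      (Finsupp.weight bidegree m) := by
  rw [aeval_monomial, algebraMap_eq]
  refine IsWeightedHomogeneous.C_mul ?_ c
  rw [Finsupp.weight_apply]
  exact IsWeightedHomogeneous.prod _ _ _ fun a _ => (isWeightedHomogeneous_minor a).pow _

/-- Substitution of the minors respects bidegrees, so the Plücker ideal is bihomogeneous and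
straightening can stay within one bidegree. -/
theorem weightedHomogeneousComponent_mem_pluckerIdeal {p : MvPolynomial (PluckerIndex n) ℂ}
    (hp : p ∈ pluckerIdeal n) (δ : (Fin n → ℕ) × (Fin n → ℕ)) :
    weightedHomogeneousComponent bidegree δ p ∈ pluckerIdeal n := by
  classical
  have key : ∀ q : MvPolynomial (PluckerIndex n) ℂ,
      aeval minor (weightedHomogeneousComponent bidegree δ q) =
        weightedHomogeneousComponent entryDegree δ (aeval minor q) := by
    intro q
    induction q using MvPolynomial.induction_on' with
    | monomial m c =>
      rw [weightedHomogeneousComponent_of_mem (isWeightedHomogeneous_monomial bidegree m c rfl),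
        weightedHomogeneousComponent_of_mem (isWeightedHomogeneous_aeval_monomial m c)]
      split_ifs <;> simp
    | add p q hp hq => rw [map_add, map_add, hp, hq, map_add, map_add]
  rw [mem_pluckerIdeal, key, mem_pluckerIdeal.1 hp, map_zero]

/-- A weight of matrix entries for which the diagonal terms of all minors are the lightest. -/
def DiagWeight (f : Fin n × Fin n → ℝ) : Prop :=
  ∀ r r' i i' : Fin n, r < r' → i < i' → f (r, i) + f (r', i') < f (r, i') + f (r', i)

theorem hasLead_minor {f : Fin n × Fin n → ℝ} (hf : DiagWeight f) (a : PluckerIndex n) :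
    HasLead f (minor a) (diagExp a) := by
  classical
  intro D hD
  rw [minor_eq, coeff_sum, Finset.sum_eq_single 1]
  · rw [coeff_monomial]
    simp only [diagExp, eq_comm]
    simp only [Equiv.Perm.sign_one, Units.val_one, Int.cast_one]
    congr
  · intro π _ hπ
    rw [coeff_monomial, if_neg]
    rintro rfl
    rw [diagExp, weight_permExp, weight_permExp] at hD
    refine absurd (sum_lt_sum_perm (fun r s => f (Fin.castLE a.len_lt.le r, a.entry s))
      (fun r r' s s' hr hs => hf _ _ _ _ hr (a.strictMono hs)) π hπ) (not_lt.2 ?_)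
    simpa using hD
  · intro h
    exact absurd (Finset.mem_univ _) h

theorem hasLead_aeval_monomial {f : Fin n × Fin n → ℝ} (hf : DiagWeight f)
    (m : PluckerIndex n →₀ ℕ) :
    HasLead f (aeval minor (monomial m (1 : ℂ))) (Finsupp.weight diagExp m) := by
  rw [aeval_monomial, map_one, one_mul, Finsupp.weight_apply]
  exact HasLead.prod _ fun a => (hasLead_minor hf a).pow _

theorem weight_weight {σ τ : Type*} (e : σ → τ →₀ ℕ) (f : τ → ℝ) (m : σ →₀ ℕ) :
    Finsupp.weight f (Finsupp.weight e m) = Finsupp.weight (fun a => Finsupp.weight f (e a)) m := by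
  rw [Finsupp.weight_apply, Finsupp.weight_apply (M := τ →₀ ℕ), Finsupp.weight_apply,
    ← Finsupp.weight_apply]
  rw [Finsupp.sum, Finsupp.sum, map_sum]
  simp only [map_nsmul]

/-- The terms of lowest weight of a Plücker relation cancel after each minor is replaced by its
diagonal term. -/
theorem sum_coeff_diagExp_eq_zero {f : Fin n × Fin n → ℝ} (hf : DiagWeight f)
    {p : MvPolynomial (PluckerIndex n) ℂ} (hp : p ∈ pluckerIdeal n) (E : Fin n × Fin n →₀ ℕ)
    (hE : ∀ m ∈ p.support,
      Finsupp.weight f E ≤ Finsupp.weight (fun a => Finsupp.weight f (diagExp a)) m) :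
    ∑ m ∈ p.support, (if Finsupp.weight diagExp m = E then coeff m p else 0) = 0 := by
  classical
  have h0 : coeff E (aeval minor p) = 0 := by rw [mem_pluckerIdeal.1 hp, coeff_zero]
  rw [p.as_sum, map_sum, coeff_sum] at h0
  refine Eq.trans (Finset.sum_congr rfl fun m hm => ?_) h0
  have h1 : monomial m (coeff m p) = C (coeff m p) * monomial m 1 := by
    rw [C_mul_monomial, mul_one]
  rw [h1, map_mul, aeval_C, algebraMap_eq, coeff_C_mul,
    hasLead_aeval_monomial hf m E (by rw [weight_weight]; exact hE m hm)]
  simp only [eq_comm, mul_ite, mul_one, mul_zero]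

end PluckerIndex

/-! ### Degrees and diagonal terms in terms of lattice paths -/

namespace PluckerIndex

open MvPolynomial

variable {n : ℕ}

theorem diagExp_apply (a : PluckerIndex n) (r i : Fin n) :
    diagExp a (r, i) = if a.count i = r ∧ a.count (i + 1) = r + 1 then 1 else 0 := by
  classical
  rw [diagExp, permExp, Finsupp.finsetSum_apply]
  simp only [Finsupp.single_apply, Equiv.Perm.one_apply, Prod.mk.injEq]
  rw [if_congr (a.count_succ_iff i r) rfl rfl]
  split_ifs with h
  · obtain ⟨hr, hi⟩ := h
    rw [Finset.sum_eq_single ⟨r, hr⟩]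
    · rw [if_pos]
      exact ⟨Fin.ext rfl, Fin.ext hi⟩
    · intro s _ hs
      rw [if_neg]
      rintro ⟨h1, -⟩
      exact hs (Fin.ext (by simpa using congrArg Fin.val h1))
    · exact fun h => absurd (Finset.mem_univ _) h
  · refine Finset.sum_eq_zero fun s _ => if_neg ?_
    rintro ⟨rfl, rfl⟩
    exact h ⟨s.2, rfl⟩

/-- Two paths cannot exchange their strict order within one step, so meet and join together make the
same two steps as `a` and `b`. -/
theorem diagExp_inf_add_sup (a b : PluckerIndex n) :
    diagExp (a ⊓ b) + diagExp (a ⊔ b) = diagExp a + diagExp b := by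
  ext ⟨r, i⟩
  have h1 := a.count_succ i
  have h2 := b.count_succ i
  have hi := i.2
  simp only [Finsupp.add_apply, diagExp_apply]
  rw [count_inf a b (by omega), count_inf a b (by omega), count_sup a b (by omega),
    count_sup a b (by omega)]
  grind

/-- Both paths are read off from left to right: the heights of the up-steps in column `t` tell which
path rises, and if only one rises from a common height, it is that of the smaller element. Hence
diagonal terms separate the standard products of two variables. -/
theorem eq_of_diagExp_add_eq {c d c' d' : PluckerIndex n} (hcd : c ≤ d) (hcd' : c' ≤ d')
    (h : diagExp c + diagExp d = diagExp c' + diagExp d') : c = c' ∧ d = d' := by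
  rw [le_iff_count] at hcd hcd'
  have key : ∀ t ≤ n, c.count t = c'.count t ∧ d.count t = d'.count t := by
    intro t
    induction t with
    | zero => intro _; simp
    | succ t ih =>
      intro ht
      obtain ⟨h1, h2⟩ := ih (by omega)
      have hc := c.count_succ t
      have hd := d.count_succ t
      have hc' := c'.count_succ t
      have hd' := d'.count_succ t
      have e1 := hcd (t + 1)
      have e2 := hcd' (t + 1)
      have hlt : ∀ x : PluckerIndex n, x.count t = x.count (t + 1) ∨ x.count t < n := by
        intro x
        have h3 := x.count_succ t
        have h4 := x.count_le_len (t + 1)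
        have h5 := x.len_lt
        omega
      have hE : ∀ r, r < n →
          (if c.count t = r ∧ c.count (t + 1) = r + 1 then 1 else 0) +
            (if d.count t = r ∧ d.count (t + 1) = r + 1 then 1 else 0) =
          (if c'.count t = r ∧ c'.count (t + 1) = r + 1 then 1 else 0) +
            (if d'.count t = r ∧ d'.count (t + 1) = r + 1 then 1 else 0) := by
        intro r hr
        have h3 := DFunLike.congr_fun h (⟨r, hr⟩, ⟨t, by omega⟩)
        simpa only [Finsupp.add_apply, diagExp_apply] using h3
      have l1 := hlt c
      have l2 := hlt d
      have l3 := hlt c'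
      have l4 := hlt d'
      rw [← h1, ← h2] at hE
      rw [← h1] at l3 hc'
      rw [← h2] at l4 hd'
      have E1 := hE (c.count t)
      have E2 := hE (d.count t)
      grind
  exact ⟨ext_count fun t ht => (key t ht).1, ext_count fun t ht => (key t ht).2⟩

theorem bidegree_eq (a : PluckerIndex n) :
    bidegree a = (∑ s : Fin a.len, Pi.single (Fin.castLE a.len_lt.le s) 1,
      ∑ s, Pi.single (a.entry s) 1) := by
  rw [bidegree, diagExp, weight_permExp]
  refine Prod.ext ?_ ?_
  · rw [Prod.fst_sum]; rfl
  · rw [Prod.snd_sum]; rfl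

theorem bidegree_fst (a : PluckerIndex n) (r : Fin n) :
    (bidegree a).1 r = if r.1 < a.len then 1 else 0 := by
  rw [bidegree_eq]
  simp only [Finset.sum_apply, Pi.single_apply]
  split_ifs with h
  · rw [Finset.sum_eq_single ⟨r, h⟩]
    · rw [if_pos]; exact Fin.ext rfl
    · intro s _ hs
      rw [if_neg]
      rintro rfl
      exact hs (Fin.ext rfl)
    · exact fun h => absurd (Finset.mem_univ _) h
  · refine Finset.sum_eq_zero fun s _ => if_neg ?_
    rintro rfl
    exact h s.2

theorem count_succ_eq (a : PluckerIndex n) (i : Fin n) :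
    a.count (i + 1) = a.count i + (bidegree a).2 i := by
  rw [bidegree_eq]
  simp only [Finset.sum_apply, Pi.single_apply]
  unfold count
  rw [Finset.card_filter, Finset.card_filter, ← Finset.sum_add_distrib]
  refine Finset.sum_congr rfl fun s _ => ?_
  simp only [Fin.ext_iff]
  split_ifs <;> omega

theorem count_add_count_eq {a b c d : PluckerIndex n}
    (h : bidegree a + bidegree b = bidegree c + bidegree d) :
    ∀ t ≤ n, a.count t + b.count t = c.count t + d.count t := by
  intro t
  induction t with
  | zero => intro _; simp
  | succ t ih =>
    intro ht
    have h1 := congrFun (congrArg Prod.snd h) ⟨t, by omega⟩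
    simp only [Prod.snd_add, Pi.add_apply] at h1
    have ha := a.count_succ_eq ⟨t, by omega⟩
    have hb := b.count_succ_eq ⟨t, by omega⟩
    have hc := c.count_succ_eq ⟨t, by omega⟩
    have hd := d.count_succ_eq ⟨t, by omega⟩
    simp only at ha hb hc hd
    have := ih (by omega)
    omega

/-- The row part of the bidegree records the multiset of the two lengths, and the smaller element is
at least as long as the other. -/
theorem count_end_eq_max {a b c d : PluckerIndex n} (hcd : c ≤ d)
    (h : bidegree a + bidegree b = bidegree c + bidegree d) :
    c.count n = max (a.count n) (b.count n) := by
  have hle := (le_iff_count _ _).1 hcd n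
  rw [count_of_le _ le_rfl, count_of_le _ le_rfl] at hle
  rw [count_of_le _ le_rfl, count_of_le _ le_rfl, count_of_le _ le_rfl]
  have ha := a.len_lt
  have hb := b.len_lt
  have hc := c.len_lt
  have hE : ∀ r, r < n → (if r < a.len then 1 else 0) + (if r < b.len then 1 else 0) =
      (if r < c.len then 1 else 0) + (if r < d.len then 1 else 0) := by
    intro r hr
    have h1 := congrFun (congrArg Prod.fst h) ⟨r, hr⟩
    simpa only [Prod.fst_add, Pi.add_apply, bidegree_fst] using h1
  have E1 := hE (c.len) hc
  have E2 := hE (max a.len b.len) (max_lt ha hb)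
  have E3 := hE (max a.len b.len - 1) (by omega)
  have E4 := hE (c.len - 1) (by omega)
  have p1 := a.len_pos
  have p2 := c.len_pos
  grind

theorem bidegree_injective {a b : PluckerIndex n} (h : bidegree a = bidegree b) : a = b := by
  refine ext_count fun t ht => ?_
  have := count_add_count_eq (a := a) (b := a) (c := b) (d := b) (by rw [h]) t ht
  omega

theorem weight_bidegree_fst_zero (m : PluckerIndex n →₀ ℕ) (hn : 0 < n) :
    (Finsupp.weight bidegree m).1 ⟨0, hn⟩ = m.degree := by
  rw [Finsupp.weight_apply, Finsupp.sum, Prod.fst_sum, Finset.sum_apply, Finsupp.degree_apply]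
  refine Finset.sum_congr rfl fun a _ => ?_
  simp [bidegree_fst, a.len_pos]

/-- Every minor uses the first row exactly once, so the bidegree fixes the degree, and there are
finitely many variables. -/
theorem finite_bidegree_fibre (δ : (Fin n → ℕ) × (Fin n → ℕ)) :
    {m : PluckerIndex n →₀ ℕ | Finsupp.weight bidegree m = δ}.Finite := by
  rcases Nat.eq_zero_or_pos n with rfl | hn
  · have : IsEmpty (PluckerIndex 0) := ⟨fun a => absurd a.len_lt (Nat.not_lt_zero _)⟩
    exact Set.toFinite _
  · refine (Finsupp.finite_of_degree_le (δ.1 ⟨0, hn⟩)).subset fun m hm => ?_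
    rw [Set.mem_ofPred_eq] at hm ⊢
    rw [← weight_bidegree_fst_zero m hn, hm]

end PluckerIndex

/-! ### Initial parts -/

section InitialPart

open MvPolynomial

variable {σ : Type*}

theorem exists_weight_min (w : σ → ℝ) {p : MvPolynomial σ ℂ} (hp : p ≠ 0) :
    ∃ m ∈ p.support, ∀ e ∈ p.support, Finsupp.weight w m ≤ Finsupp.weight w e :=
  Finset.exists_min_image _ _ (support_nonempty.2 hp)

theorem coeff_initialPart (w : σ → ℝ) {p : MvPolynomial σ ℂ} {m : σ →₀ ℕ} (hm : m ∈ p.support)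
    (hmin : ∀ e ∈ p.support, Finsupp.weight w m ≤ Finsupp.weight w e) (d : σ →₀ ℕ) :
    coeff d (initialPart w p) =
      open Classical in if Finsupp.weight w d = Finsupp.weight w m then coeff d p else 0 := by
  classical
  unfold initialPart
  rw [coeff_sum]
  simp only [coeff_monomial]
  rw [Finset.sum_ite_eq']
  simp only [Finset.mem_filter]
  by_cases hd : d ∈ p.support
  · by_cases hw : Finsupp.weight w d = Finsupp.weight w m
    · rw [if_pos ⟨hd, fun e he => hw ▸ hmin e he⟩, if_pos hw]
    · rw [if_neg, if_neg hw]
      rintro ⟨-, h⟩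
      exact hw (le_antisymm (h m hm) (hmin d hd))
  · rw [notMem_support_iff.1 hd]
    simp

theorem initialPart_zero (w : σ → ℝ) : initialPart w (0 : MvPolynomial σ ℂ) = 0 := by
  simp [initialPart]

theorem mem_support_initialPart (w : σ → ℝ) {p : MvPolynomial σ ℂ} {m : σ →₀ ℕ}
    (hm : m ∈ p.support) (hmin : ∀ e ∈ p.support, Finsupp.weight w m ≤ Finsupp.weight w e)
    (d : σ →₀ ℕ) : d ∈ (initialPart w p).support ↔
      d ∈ p.support ∧ Finsupp.weight w d = Finsupp.weight w m := by
  classical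
  rw [mem_support_iff, coeff_initialPart w hm hmin, mem_support_iff]
  split_ifs with h <;> simp [h]

theorem initialPart_mem_initialSpan (w : σ → ℝ) {I : Ideal (MvPolynomial σ ℂ)}
    {p : MvPolynomial σ ℂ} (hp : p ∈ I) : initialPart w p ∈ initialSpan w I :=
  Submodule.subset_span ⟨p, hp, rfl⟩

/-- Each homogeneous part of an element of the initial ideal is the lowest part of an element of
the ideal. -/
theorem exists_lift_of_mem_initialSpan (w : σ → ℝ) {I : Ideal (MvPolynomial σ ℂ)}
    {q : MvPolynomial σ ℂ} (hq : q ∈ initialSpan w I) (v : ℝ) :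
    ∃ p ∈ I, ∀ m, (Finsupp.weight w m < v → coeff m p = 0) ∧
      (Finsupp.weight w m = v → coeff m p = coeff m q) := by
  classical
  refine Submodule.span_induction ?_ ?_ ?_ ?_ hq
  · rintro _ ⟨p, hp, rfl⟩
    by_cases h0 : p = 0
    · subst h0
      exact ⟨0, I.zero_mem, by simp [initialPart_zero]⟩
    · obtain ⟨m₀, hm₀, hmin⟩ := exists_weight_min w h0
      -- An initial part lives in one weight only; for any other `v` the lift is `0`.
      by_cases hv : Finsupp.weight w m₀ = v
      · refine ⟨p, hp, fun m => ⟨fun hm => ?_, fun hm => ?_⟩⟩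
        · by_contra hne
          have := hmin m (mem_support_iff.2 hne)
          linarith
        · rw [coeff_initialPart w hm₀ hmin, if_pos (hm.trans hv.symm)]
      · refine ⟨0, I.zero_mem, fun m => ⟨fun _ => coeff_zero m, fun hm => ?_⟩⟩
        rw [coeff_initialPart w hm₀ hmin, if_neg, coeff_zero]
        rintro h
        exact hv (h ▸ hm)
  · exact ⟨0, I.zero_mem, by simp⟩
  · rintro q q' - - ⟨p, hp, h⟩ ⟨p', hp', h'⟩
    refine ⟨p + p', I.add_mem hp hp', fun m => ⟨fun hm => ?_, fun hm => ?_⟩⟩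
    · rw [coeff_add, (h m).1 hm, (h' m).1 hm, add_zero]
    · rw [coeff_add, coeff_add, (h m).2 hm, (h' m).2 hm]
  · rintro c q - ⟨p, hp, h⟩
    refine ⟨c • p, Submodule.smul_of_tower_mem I c hp, fun m => ⟨fun hm => ?_, fun hm => ?_⟩⟩
    · rw [coeff_smul, (h m).1 hm, smul_zero]
    · rw [coeff_smul, coeff_smul, (h m).2 hm]

theorem mem_groebnerCone {w : σ → ℝ} {I J : Ideal (MvPolynomial σ ℂ)} :
    w ∈ groebnerCone I J ↔ ∀ q, q ∈ initialSpan w I ↔ q ∈ J := by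
  change initialSpan w I = J.restrictScalars ℂ ↔ _
  rw [Submodule.ext_iff]
  rfl

end InitialPart

/-! ### Standard monomials -/

section Standard

open MvPolynomial

variable {L : Type*} [Lattice L]

/-- The exponent of the product of two variables. -/
noncomputable def pairExp {σ : Type*} (a b : σ) : σ →₀ ℕ :=
  Finsupp.single a 1 + Finsupp.single b 1

theorem pairExp_comm {σ : Type*} (a b : σ) : pairExp a b = pairExp b a := add_comm _ _

theorem weight_pairExp {σ M : Type*} [AddCommMonoid M] (w : σ → M) (a b : σ) :
    Finsupp.weight w (pairExp a b) = w a + w b := by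
  simp [pairExp, Finsupp.weight_single]

theorem monomial_pairExp {σ : Type*} (a b : σ) :
    monomial (pairExp a b) (1 : ℂ) = X a * X b := by
  rw [pairExp, ← one_mul (1 : ℂ), ← monomial_mul]
  simp [X]

/-- A monomial is nonstandard if it is divisible by the product of two incomparable variables. -/
def Nonstandard (m : L →₀ ℕ) : Prop :=
  ∃ a b : L, ¬ a ≤ b ∧ ¬ b ≤ a ∧ pairExp a b ≤ m

theorem mem_nonstandardIdeal {p : MvPolynomial L ℂ} :
    p ∈ nonstandardIdeal L ↔ ∀ m ∈ p.support, Nonstandard m := by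
  have h : nonstandardIdeal L = Ideal.span ((fun s => monomial s (1 : ℂ)) ''
      {s | ∃ a b : L, ¬ a ≤ b ∧ ¬ b ≤ a ∧ s = pairExp a b}) := by
    unfold nonstandardIdeal
    congr 1
    ext q
    constructor
    · rintro ⟨a, b, h1, h2, rfl⟩
      exact ⟨_, ⟨a, b, h1, h2, rfl⟩, monomial_pairExp a b⟩
    · rintro ⟨_, ⟨a, b, h1, h2, rfl⟩, rfl⟩
      exact ⟨a, b, h1, h2, monomial_pairExp a b⟩
  rw [h, mem_ideal_span_monomial_image]
  refine forall₂_congr fun m _ => ⟨?_, ?_⟩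
  · rintro ⟨_, ⟨a, b, h1, h2, rfl⟩, h3⟩
    exact ⟨a, b, h1, h2, h3⟩
  · rintro ⟨a, b, h1, h2, h3⟩
    exact ⟨_, ⟨a, b, h1, h2, rfl⟩, h3⟩

theorem nonstandard_pairExp {a b : L} (hab : ¬ a ≤ b) (hba : ¬ b ≤ a) :
    Nonstandard (pairExp a b) := ⟨a, b, hab, hba, le_rfl⟩

theorem not_nonstandard_pairExp {c d : L} (hcd : c ≤ d) : ¬ Nonstandard (pairExp c d) := by
  classical
  rintro ⟨a, b, hab, hba, hle⟩
  have hmem : ∀ x, pairExp a b x ≠ 0 → x = c ∨ x = d := by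
    intro x hx
    by_contra hcon
    push Not at hcon
    have h1 : pairExp c d x = 0 := by
      simp [pairExp, hcon.1.symm, hcon.2.symm]
    exact hx (Nat.le_zero.1 (h1 ▸ hle x))
  have ha := hmem a (by simp [pairExp])
  have hb := hmem b (by simp [pairExp])
  rcases ha with rfl | rfl <;> rcases hb with rfl | rfl
  · exact hab le_rfl
  · exact hab hcd
  · exact hba hcd
  · exact hab le_rfl

/-- A standard monomial of degree two is a product of two comparable variables. -/
theorem exists_pairExp_of_degree {m : L →₀ ℕ} (hdeg : m.degree = 2) (hm : ¬ Nonstandard m) :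
    ∃ c d : L, c ≤ d ∧ m = pairExp c d := by
  classical
  have h0 : m ≠ 0 := by
    rintro rfl
    simp at hdeg
  obtain ⟨c, hc⟩ := Finsupp.ne_iff.1 h0
  have hc' : Finsupp.single c 1 ≤ m := by
    rw [Finsupp.single_le_iff]
    exact Nat.one_le_iff_ne_zero.2 hc
  obtain ⟨m', rfl⟩ := exists_add_of_le hc'
  rw [map_add, Finsupp.degree_single] at hdeg
  have h1 : m' ≠ 0 := by
    rintro rfl
    simp at hdeg
  obtain ⟨d, hd⟩ := Finsupp.ne_iff.1 h1
  have hd' : Finsupp.single d 1 ≤ m' := by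
    rw [Finsupp.single_le_iff]
    exact Nat.one_le_iff_ne_zero.2 hd
  obtain ⟨m'', rfl⟩ := exists_add_of_le hd'
  rw [map_add, Finsupp.degree_single] at hdeg
  have h2 : m'' = 0 := (Finsupp.degree_eq_zero_iff _).1 (by omega)
  subst h2
  rw [add_zero] at hm ⊢
  by_cases hcd : c ≤ d
  · exact ⟨c, d, hcd, rfl⟩
  · by_cases hdc : d ≤ c
    · exact ⟨d, c, hdc, add_comm _ _⟩
    · exact absurd (nonstandard_pairExp hcd hdc) hm

end Standard

/-! ### Normal forms modulo the Plücker ideal -/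

namespace PluckerIndex

open MvPolynomial

variable {n : ℕ}

/-- Induction on monomials of a fixed bidegree, from heavier to lighter ones. -/
theorem heavier_induction (w : PluckerIndex n → ℝ) (P : (PluckerIndex n →₀ ℕ) → Prop)
    (h : ∀ m, (∀ m', Finsupp.weight bidegree m' = Finsupp.weight bidegree m →
      Finsupp.weight w m < Finsupp.weight w m' → P m') → P m) (m : PluckerIndex n →₀ ℕ) : P m := by
  -- Bidegree fibres are finite, so the number of heavier monomials of the same bidegree is a
  -- decreasing measure.
  suffices key : ∀ k : ℕ, ∀ m : PluckerIndex n →₀ ℕ,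
      {m' : PluckerIndex n →₀ ℕ | Finsupp.weight bidegree m' = Finsupp.weight bidegree m ∧
        Finsupp.weight w m < Finsupp.weight w m'}.ncard < k → P m from key _ m (Nat.lt_succ_self _)
  intro k
  induction k with
  | zero => exact fun m hm => absurd hm (Nat.not_lt_zero _)
  | succ k ih =>
    intro m hm
    refine h m fun m' hd hw => ih m' (lt_of_lt_of_le ?_ (Nat.lt_succ_iff.1 hm))
    refine Set.ncard_lt_ncard ⟨fun x hx => ?_, fun hsub => ?_⟩
      ((finite_bidegree_fibre (Finsupp.weight bidegree m)).subset fun x hx => hx.1)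
    · exact ⟨hx.1.trans hd, hw.trans hx.2⟩
    · exact lt_irrefl _ (hsub ⟨hd, hw⟩ : _ ∧ _).2

/-- `nf` sends each monomial to a combination of standard monomials of the same bidegree to which
it is congruent modulo the Plücker ideal, and this combination is unique. The weight `w₀` increases
when a nonstandard monomial is replaced by its normal form. -/
structure IsNormalForm (nf : (PluckerIndex n →₀ ℕ) → MvPolynomial (PluckerIndex n) ℂ)
    (w₀ : PluckerIndex n → ℝ) : Prop where
  sub_mem : ∀ m, monomial m 1 - nf m ∈ pluckerIdeal n
  standard : ∀ m, ∀ q ∈ (nf m).support, ¬ Nonstandard q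
  bidegree_eq : ∀ m, ∀ q ∈ (nf m).support, Finsupp.weight bidegree q = Finsupp.weight bidegree m
  eq_zero : ∀ p ∈ pluckerIdeal n, (∀ q ∈ p.support, ¬ Nonstandard q) → p = 0
  weight_lt : ∀ m, Nonstandard m → ∀ q ∈ (nf m).support, Finsupp.weight w₀ m < Finsupp.weight w₀ q

theorem eq_zero_of_standard {w : PluckerIndex n → ℝ}
    (hw : w ∈ groebnerCone (pluckerIdeal n) (nonstandardIdeal (PluckerIndex n)))
    {p : MvPolynomial (PluckerIndex n) ℂ} (hp : p ∈ pluckerIdeal n)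
    (hs : ∀ q ∈ p.support, ¬ Nonstandard q) : p = 0 := by
  by_contra h0
  obtain ⟨m, hm, hmin⟩ := exists_weight_min w h0
  have h1 := mem_nonstandardIdeal.1
    ((mem_groebnerCone.1 hw _).1 (initialPart_mem_initialSpan w hp))
  exact hs m hm (h1 m ((mem_support_initialPart w hm hmin m).2 ⟨hm, rfl⟩))

/-- All terms of the initial part of the relation are nonstandard, and `m` is the only nonstandard
term available. -/
theorem weight_lt_of_mem_cone {w : PluckerIndex n → ℝ}
    (hw : w ∈ groebnerCone (pluckerIdeal n) (nonstandardIdeal (PluckerIndex n)))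
    {m : PluckerIndex n →₀ ℕ} (hm : Nonstandard m) {s : MvPolynomial (PluckerIndex n) ℂ}
    (hs : monomial m 1 - s ∈ pluckerIdeal n) (hstd : ∀ q ∈ s.support, ¬ Nonstandard q) :
    ∀ q ∈ s.support, Finsupp.weight w m < Finsupp.weight w q := by
  classical
  have hms : m ∉ s.support := fun h => hstd m h hm
  have hcoeff : ∀ q, coeff q (monomial m (1 : ℂ) - s) =
      if m = q then 1 else - coeff q s := by
    intro q
    rw [coeff_sub, coeff_monomial]
    split_ifs with h
    · subst h
      rw [notMem_support_iff.1 hms, sub_zero]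
    · rw [zero_sub]
  have hmem : ∀ q, q ∈ (monomial m (1 : ℂ) - s).support ↔ q = m ∨ q ∈ s.support := by
    intro q
    rw [mem_support_iff, hcoeff]
    split_ifs with h
    · simp [h]
    · simp [Ne.symm h]
  have h0 : monomial m (1 : ℂ) - s ≠ 0 := by
    rw [← support_nonempty]
    exact ⟨m, (hmem m).2 (Or.inl rfl)⟩
  obtain ⟨m₀, hm₀, hmin⟩ := exists_weight_min w h0
  have h1 := mem_nonstandardIdeal.1
    ((mem_groebnerCone.1 hw _).1 (initialPart_mem_initialSpan w hs))
  have h2 : ∀ q ∈ (monomial m (1 : ℂ) - s).support,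
      Finsupp.weight w q = Finsupp.weight w m₀ → q = m := by
    intro q hq hqw
    have h3 := h1 q ((mem_support_initialPart w hm₀ hmin q).2 ⟨hq, hqw⟩)
    rcases (hmem q).1 hq with h | h
    · exact h
    · exact absurd h3 (hstd q h)
  have h3 := h2 m₀ hm₀ rfl
  subst h3
  intro q hq
  have hq' := (hmem q).2 (Or.inr hq)
  refine lt_of_le_of_ne (hmin q hq') fun h => ?_
  rw [h2 q hq' h.symm] at hq
  exact hms hq

/-- A nonstandard monomial is the lowest term of some Plücker relation, which can be cut down to one
bidegree. Rewriting by it leads to heavier monomials of that bidegree, so the process terminates. -/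
theorem exists_isNormalForm {w : PluckerIndex n → ℝ}
    (hw : w ∈ groebnerCone (pluckerIdeal n) (nonstandardIdeal (PluckerIndex n))) :
    ∃ nf, IsNormalForm nf w := by
  classical
  let S : (PluckerIndex n →₀ ℕ) → Submodule ℂ (MvPolynomial (PluckerIndex n) ℂ) := fun m =>
    restrictSupport ℂ {q | ¬ Nonstandard q ∧
      Finsupp.weight bidegree q = Finsupp.weight bidegree m}
  have hex : ∀ m, monomial m (1 : ℂ) ∈ (pluckerIdeal n).restrictScalars ℂ ⊔ S m := by
    intro m
    induction m using heavier_induction w with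
    | h m ih =>
    by_cases hm : Nonstandard m
    · have h1 : monomial m (1 : ℂ) ∈ initialSpan w (pluckerIdeal n) := by
        rw [mem_groebnerCone.1 hw, mem_nonstandardIdeal]
        intro q hq
        have h2 := support_monomial_subset hq
        rw [Finset.mem_singleton] at h2
        exact h2 ▸ hm
      obtain ⟨p, hp, hpc⟩ := exists_lift_of_mem_initialSpan w h1 (Finsupp.weight w m)
      have hp' := weightedHomogeneousComponent_mem_pluckerIdeal hp (Finsupp.weight bidegree m)
      set p' := weightedHomogeneousComponent bidegree (Finsupp.weight bidegree m) p with hp'_def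
      have hc : ∀ q, coeff q p' =
          if Finsupp.weight bidegree q = Finsupp.weight bidegree m then coeff q p else 0 :=
        fun q => coeff_weightedHomogeneousComponent _ _ _
      have hother : ∀ q ∈ (p' - monomial m 1).support,
          Finsupp.weight bidegree q = Finsupp.weight bidegree m ∧
            Finsupp.weight w m < Finsupp.weight w q := by
        intro q hq
        rw [mem_support_iff, coeff_sub, coeff_monomial, hc] at hq
        have hqm : q ≠ m := by
          rintro rfl
          rw [if_pos rfl, if_pos rfl, (hpc q).2 rfl, coeff_monomial, if_pos rfl, sub_self] at hq
          exact hq rfl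
        rw [if_neg hqm.symm, sub_zero] at hq
        have hd : Finsupp.weight bidegree q = Finsupp.weight bidegree m := by
          by_contra hd
          rw [if_neg hd] at hq
          exact hq rfl
        rw [if_pos hd] at hq
        refine ⟨hd, ?_⟩
        by_contra hlt
        rcases lt_or_eq_of_le (not_lt.1 hlt) with h | h
        · exact hq ((hpc q).1 h)
        · rw [(hpc q).2 h, coeff_monomial, if_neg hqm.symm] at hq
          exact hq rfl
      have h3 : p' - monomial m 1 ∈ (pluckerIdeal n).restrictScalars ℂ ⊔ S m := by
        rw [(p' - monomial m (1 : ℂ)).as_sum]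
        refine Submodule.sum_mem _ fun q hq => ?_
        obtain ⟨hd, hlt⟩ := hother q hq
        have h4 := ih q hd hlt
        have h5 : S q = S m := by simp only [S, hd]
        rw [h5] at h4
        have h6 := Submodule.smul_mem _ (coeff q (p' - monomial m 1)) h4
        rwa [smul_monomial, smul_eq_mul, mul_one] at h6
      have h4 : p' ∈ (pluckerIdeal n).restrictScalars ℂ ⊔ S m :=
        Submodule.mem_sup_left hp'
      simpa using Submodule.sub_mem _ h4 h3
    · exact Submodule.mem_sup_right ((monomial_mem_restrictSupport ℂ).2 (Or.inl ⟨hm, rfl⟩))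
  have hex' : ∀ m, ∃ s, monomial m 1 - s ∈ pluckerIdeal n ∧ ∀ q ∈ s.support, ¬ Nonstandard q ∧
      Finsupp.weight bidegree q = Finsupp.weight bidegree m := by
    intro m
    obtain ⟨p, hp, s, hs, hps⟩ := Submodule.mem_sup.1 (hex m)
    refine ⟨s, ?_, fun q hq => (mem_restrictSupport_iff ℂ).1 hs hq⟩
    rw [← hps, add_sub_cancel_right]
    exact hp
  choose nf h1 h2 using hex'
  exact ⟨nf, h1, fun m q hq => (h2 m q hq).1, fun m q hq => (h2 m q hq).2,
    fun p hp hs => eq_zero_of_standard hw hp hs,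
    fun m hm => weight_lt_of_mem_cone hw hm (h1 m) fun q hq => (h2 m q hq).1⟩

/-! ### Calculus of normal forms and the cone of the monomial ideal. -/

namespace IsNormalForm

variable {nf : (PluckerIndex n →₀ ℕ) → MvPolynomial (PluckerIndex n) ℂ} {w₀ : PluckerIndex n → ℝ}

theorem unique (h : IsNormalForm nf w₀) {m : PluckerIndex n →₀ ℕ}
    {s : MvPolynomial (PluckerIndex n) ℂ} (hs : monomial m 1 - s ∈ pluckerIdeal n)
    (hstd : ∀ q ∈ s.support, ¬ Nonstandard q) : nf m = s := by
  classical
  refine sub_eq_zero.1 (h.eq_zero _ ?_ fun q hq => ?_)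
  · have := (pluckerIdeal n).sub_mem hs (h.sub_mem m)
    rwa [sub_sub_sub_cancel_left] at this
  · rcases Finset.mem_union.1 (support_sub _ _ _ hq) with h1 | h1
    · exact h.standard m q h1
    · exact hstd q h1

theorem of_standard (h : IsNormalForm nf w₀) {m : PluckerIndex n →₀ ℕ} (hm : ¬ Nonstandard m) :
    nf m = monomial m 1 := by
  refine h.unique (by rw [sub_self]; exact Ideal.zero_mem _) fun q hq => ?_
  have h1 := support_monomial_subset hq
  rw [Finset.mem_singleton] at h1
  exact h1 ▸ hm

/-- The linear extension of the normal form map vanishes on the ideal. -/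
theorem sum_eq_zero (h : IsNormalForm nf w₀) {p : MvPolynomial (PluckerIndex n) ℂ}
    (hp : p ∈ pluckerIdeal n) : ∑ m ∈ p.support, coeff m p • nf m = 0 := by
  classical
  refine h.eq_zero _ ?_ fun q hq => ?_
  · have h1 : p - ∑ m ∈ p.support, coeff m p • nf m =
        ∑ m ∈ p.support, coeff m p • (monomial m 1 - nf m) := by
      conv_lhs => rw [p.as_sum]
      simp only [smul_sub, Finset.sum_sub_distrib, smul_monomial, smul_eq_mul, mul_one]
      congr 1
      rw [← p.as_sum]
    have h2 : p - ∑ m ∈ p.support, coeff m p • nf m ∈ pluckerIdeal n := by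
      rw [h1]
      exact Ideal.sum_mem _ fun m _ => Submodule.smul_of_tower_mem _ _ (h.sub_mem m)
    simpa using (pluckerIdeal n).sub_mem hp h2
  · obtain ⟨m, -, hm⟩ := Finset.mem_biUnion.1 (support_sum hq)
    exact h.standard m q (support_smul hm)

/-- By uniqueness, straightening a product may start with any of its factors. -/
theorem add_eq (h : IsNormalForm nf w₀) (u m : PluckerIndex n →₀ ℕ) :
    nf (u + m) = ∑ q ∈ (nf m).support, coeff q (nf m) • nf (u + q) := by
  classical
  refine h.unique ?_ fun q hq => ?_
  · have h1 : monomial (u + m) (1 : ℂ) - ∑ q ∈ (nf m).support, coeff q (nf m) • nf (u + q) =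
        monomial u 1 * (monomial m 1 - nf m) +
          ∑ q ∈ (nf m).support, coeff q (nf m) • (monomial (u + q) 1 - nf (u + q)) := by
      have h2 : monomial u (1 : ℂ) * nf m =
          ∑ q ∈ (nf m).support, coeff q (nf m) • monomial (u + q) 1 := by
        conv_lhs => rw [(nf m).as_sum]
        rw [Finset.mul_sum]
        refine Finset.sum_congr rfl fun q _ => ?_
        rw [monomial_mul, smul_monomial, smul_eq_mul, mul_one, one_mul]
      simp only [smul_sub, Finset.sum_sub_distrib]
      rw [← h2, mul_sub, monomial_mul, one_mul]
      ring
    rw [h1]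
    exact Ideal.add_mem _ (Ideal.mul_mem_left _ _ (h.sub_mem m))
      (Ideal.sum_mem _ fun q _ => Submodule.smul_of_tower_mem _ _ (h.sub_mem _))
  · obtain ⟨m', -, hm⟩ := Finset.mem_biUnion.1 (support_sum hq)
    exact h.standard _ q (support_smul hm)

theorem exists_of_mem_support_add (h : IsNormalForm nf w₀) {u m q : PluckerIndex n →₀ ℕ}
    (hq : q ∈ (nf (u + m)).support) :
    ∃ r ∈ (nf m).support, q ∈ (nf (u + r)).support := by
  classical
  rw [h.add_eq] at hq
  obtain ⟨r, hr, hm⟩ := Finset.mem_biUnion.1 (support_sum hq)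
  exact ⟨r, hr, support_smul hm⟩

/-- The weights for which no straightening relation has a term lighter than its nonstandard
term. -/
def Weak (nf : (PluckerIndex n →₀ ℕ) → MvPolynomial (PluckerIndex n) ℂ)
    (w : PluckerIndex n → ℝ) : Prop :=
  ∀ a b, ¬ a ≤ b → ¬ b ≤ a → ∀ q ∈ (nf (pairExp a b)).support,
    Finsupp.weight w (pairExp a b) ≤ Finsupp.weight w q

theorem exists_add_pairExp {m : PluckerIndex n →₀ ℕ} (hm : Nonstandard m) :
    ∃ u a b, ¬ a ≤ b ∧ ¬ b ≤ a ∧ m = u + pairExp a b := by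
  obtain ⟨a, b, hab, hba, hle⟩ := hm
  obtain ⟨u, rfl⟩ := exists_add_of_le hle
  exact ⟨u, a, b, hab, hba, add_comm _ _⟩

/-- The recursion is governed by `w₀`, which strictly grows under straightening, since `w` may stay
constant. Each step straightens one incomparable pair. -/
theorem weight_le (h : IsNormalForm nf w₀) {w : PluckerIndex n → ℝ} (hw : Weak nf w)
    (m : PluckerIndex n →₀ ℕ) : ∀ q ∈ (nf m).support, Finsupp.weight w m ≤ Finsupp.weight w q := by
  induction m using heavier_induction w₀ with
  | h m ih =>
  by_cases hm : Nonstandard m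
  · obtain ⟨u, a, b, hab, hba, rfl⟩ := exists_add_pairExp hm
    intro q hq
    obtain ⟨r, hr, hqr⟩ := h.exists_of_mem_support_add hq
    have h1 := ih (u + r) (by rw [map_add, map_add, h.bidegree_eq _ r hr])
      (by
        rw [map_add, map_add]
        have := h.weight_lt _ (nonstandard_pairExp hab hba) r hr
        linarith) q hqr
    refine le_trans ?_ h1
    rw [map_add, map_add]
    have := hw a b hab hba r hr
    linarith
  · intro q hq
    rw [h.of_standard hm] at hq
    have h1 := support_monomial_subset hq
    rw [Finset.mem_singleton] at h1
    rw [h1]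

theorem self_notMem_support (h : IsNormalForm nf w₀) {m : PluckerIndex n →₀ ℕ}
    (hm : Nonstandard m) : m ∉ (nf m).support := fun h1 => h.standard m m h1 hm

theorem mem_support_sub_iff (h : IsNormalForm nf w₀) {m : PluckerIndex n →₀ ℕ}
    (hm : Nonstandard m) (q : PluckerIndex n →₀ ℕ) :
    q ∈ (monomial m (1 : ℂ) - nf m).support ↔ q = m ∨ q ∈ (nf m).support := by
  classical
  rw [mem_support_iff, coeff_sub, coeff_monomial]
  split_ifs with h1
  · subst h1
    simp [notMem_support_iff.1 (h.self_notMem_support hm)]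
  · simp [Ne.symm h1]

/-- One straightening step raises the weight strictly and the rest does not lower it, so strictness
passes from pairs to all nonstandard monomials. A standard lowest term of an element of the ideal
would then survive in the combination of normal forms, which vanishes by `sum_eq_zero`. -/
theorem mem_cone_nonstandard (h : IsNormalForm nf w₀) {w : PluckerIndex n → ℝ}
    (hw : ∀ a b, ¬ a ≤ b → ¬ b ≤ a → ∀ q ∈ (nf (pairExp a b)).support,
      Finsupp.weight w (pairExp a b) < Finsupp.weight w q) :
    w ∈ groebnerCone (pluckerIdeal n) (nonstandardIdeal (PluckerIndex n)) := by
  classical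
  have hweak : Weak nf w := fun a b hab hba q hq => (hw a b hab hba q hq).le
  have hlt : ∀ m, Nonstandard m → ∀ q ∈ (nf m).support,
      Finsupp.weight w m < Finsupp.weight w q := by
    intro m hm q hq
    obtain ⟨u, a, b, hab, hba, rfl⟩ := exists_add_pairExp hm
    obtain ⟨r, hr, hqr⟩ := h.exists_of_mem_support_add hq
    refine lt_of_lt_of_le ?_ (h.weight_le hweak _ q hqr)
    rw [map_add, map_add]
    have := hw a b hab hba r hr
    linarith
  rw [mem_groebnerCone]
  intro q
  constructor
  · intro hq
    refine (Submodule.span_le (p := (nonstandardIdeal (PluckerIndex n)).restrictScalars ℂ)).2 ?_ hq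
    rintro _ ⟨p, hp, rfl⟩
    change initialPart w p ∈ nonstandardIdeal (PluckerIndex n)
    by_cases h0 : p = 0
    · rw [h0, initialPart_zero]
      exact Ideal.zero_mem _
    obtain ⟨m₀, hm₀, hmin⟩ := exists_weight_min w h0
    rw [mem_nonstandardIdeal]
    intro m hm
    obtain ⟨hmp, hmw⟩ := (mem_support_initialPart w hm₀ hmin m).1 hm
    by_contra hstd
    have h1 := congrArg (coeff m) (h.sum_eq_zero hp)
    rw [coeff_sum, coeff_zero, Finset.sum_eq_single m] at h1
    · rw [h.of_standard hstd, coeff_smul, coeff_monomial, if_pos rfl, smul_eq_mul, mul_one] at h1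
      exact mem_support_iff.1 hmp h1
    · intro e he hem
      rw [coeff_smul, smul_eq_mul, mul_eq_zero]
      right
      by_contra hne
      rw [← ne_eq, ← mem_support_iff] at hne
      by_cases hee : Nonstandard e
      · have h2 := hlt e hee m hne
        have h3 := hmin e he
        linarith
      · rw [h.of_standard hee] at hne
        have h2 := support_monomial_subset hne
        rw [Finset.mem_singleton] at h2
        exact hem h2.symm
    · exact fun h2 => absurd hmp h2
  · intro hq
    rw [mem_nonstandardIdeal] at hq
    rw [q.as_sum]
    refine Submodule.sum_mem _ fun m hm => ?_
    have hmn := hq m hm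
    have h1 : initialPart w (monomial m (1 : ℂ) - nf m) = monomial m 1 := by
      have hmem := (h.mem_support_sub_iff hmn m).2 (Or.inl rfl)
      have hmin : ∀ e ∈ (monomial m (1 : ℂ) - nf m).support,
          Finsupp.weight w m ≤ Finsupp.weight w e := by
        intro e he
        rcases (h.mem_support_sub_iff hmn e).1 he with rfl | h2
        · exact le_rfl
        · exact (hlt m hmn e h2).le
      ext d
      rw [coeff_initialPart w hmem hmin, coeff_sub]
      by_cases hd : d ∈ (nf m).support
      · have h2 := hlt m hmn d hd
        have h3 : m ≠ d := fun h3 => h.self_notMem_support hmn (h3 ▸ hd)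
        rw [if_neg h2.ne', coeff_monomial, if_neg h3]
      · rw [notMem_support_iff.1 hd, sub_zero, coeff_monomial]
        by_cases h3 : m = d
        · subst h3
          simp
        · simp [h3]
    have h2 := initialPart_mem_initialSpan w (h.sub_mem m)
    rw [h1] at h2
    have h3 := Submodule.smul_mem _ (coeff m q) h2
    rwa [smul_monomial, smul_eq_mul, mul_one] at h3

end IsNormalForm

end PluckerIndex

/-! ### Toric initial forms and the Hibi cone -/

namespace PluckerIndex

open MvPolynomial

variable {n : ℕ}

/-- Strict convexity of every sequence `G t`. -/
def StrictlyConvex (G : ℕ → ℕ → ℝ) : Prop :=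
  ∀ t m, 2 * G t (m + 1) < G t m + G t (m + 2)

/-- The weights of matrix entries which induce the path weights given by `G`. -/
noncomputable def entryWeight (n : ℕ) (G : ℕ → ℕ → ℝ) (p : Fin n × Fin n) : ℝ :=
  ∑ s ∈ Finset.range n, if p.2.1 ≤ s then G s (p.1 + 1) - G s p.1 else 0

/-- For rows `r < r'`, the difference of the two weights in a column `i` sums the growth of the
slopes of `G s` over `s ≥ i`. This growth is positive, and a smaller column has more summands. -/
theorem StrictlyConvex.diagWeight {G : ℕ → ℕ → ℝ} (hG : StrictlyConvex G) :
    DiagWeight (entryWeight n G) := by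
  intro r r' i i' hr hi
  have hD : ∀ s, G s (r + 1) - G s r < G s (r' + 1) - G s r' := by
    intro s
    have hmono : StrictMono fun m => G s (m + 1) - G s m :=
      strictMono_nat_of_lt_succ fun m => by
        have := hG s m
        linarith
    exact hmono (Fin.lt_def.1 hr)
  have h1 : entryWeight n G (r', i') - entryWeight n G (r, i') <
      entryWeight n G (r', i) - entryWeight n G (r, i) := by
    unfold entryWeight
    rw [← Finset.sum_sub_distrib, ← Finset.sum_sub_distrib]
    rw [Fin.lt_def] at hi
    refine Finset.sum_lt_sum (fun s _ => ?_) ⟨i, Finset.mem_range.2 i.2, ?_⟩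
    · have := hD s
      split_ifs <;> first | omega | linarith
    · have := hD i
      rw [if_neg (by simp only; omega), if_neg (by simp only; omega), if_pos le_rfl,
        if_pos le_rfl]
      linarith
  linarith

/-- For fixed `t`, the entries that are at most `t` are the first `a.count (t + 1)` ones, so their
slopes telescope. -/
theorem weight_entryWeight (G : ℕ → ℕ → ℝ) (hG : ∀ t, G t 0 = 0) (a : PluckerIndex n) :
    Finsupp.weight (entryWeight n G) (diagExp a) = pathWeight G a := by
  rw [diagExp, weight_permExp]
  unfold entryWeight pathWeight
  rw [Finset.sum_comm]
  refine Finset.sum_congr rfl fun t _ => ?_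
  have h1 : ∀ r : Fin a.len, (a.entry r).1 ≤ t ↔ r.1 < a.count (t + 1) := fun r => by
    rw [← a.entry_lt_iff, Nat.lt_succ_iff]
  simp only [Equiv.Perm.one_apply, h1, Fin.val_castLE]
  rw [Fin.sum_univ_eq_sum_range
    (fun r => if r < a.count (t + 1) then G t (r + 1) - G t r else 0) a.len,
    ← Finset.sum_filter]
  have h2 : (Finset.range a.len).filter (fun r => r < a.count (t + 1)) =
      Finset.range (a.count (t + 1)) := by
    ext r
    have := a.count_le_len (t + 1)
    simp only [Finset.mem_filter, Finset.mem_range]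
    omega
  rw [h2, Finset.sum_range_sub (G t), hG, sub_zero]

/-- The ideal of relations between the diagonal terms of the minors. -/
noncomputable def diagIdeal (n : ℕ) : Ideal (MvPolynomial (PluckerIndex n) ℂ) :=
  RingHom.ker (aeval fun a : PluckerIndex n => monomial (diagExp a) (1 : ℂ) :
    MvPolynomial (PluckerIndex n) ℂ →ₐ[ℂ] MvPolynomial (Fin n × Fin n) ℂ)

theorem mem_diagIdeal {p : MvPolynomial (PluckerIndex n) ℂ} : p ∈ diagIdeal n ↔
    ∀ E, ∑ m ∈ p.support, (open Classical in
      if Finsupp.weight diagExp m = E then coeff m p else 0) = 0 := by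
  classical
  have h1 : ∀ m (c : ℂ), aeval (fun a : PluckerIndex n => monomial (diagExp a) (1 : ℂ))
      (monomial m c) = monomial (Finsupp.weight diagExp m) c := by
    intro m c
    rw [aeval_monomial, algebraMap_eq, Finsupp.weight_apply, Finsupp.prod, Finsupp.sum]
    simp only [monomial_pow, one_pow]
    rw [← monomial_sum_one, C_mul_monomial, mul_one]
  have h2 : p ∈ diagIdeal n ↔
      aeval (fun a : PluckerIndex n => monomial (diagExp a) (1 : ℂ)) p = 0 := Iff.rfl
  rw [h2, MvPolynomial.ext_iff]
  refine forall_congr' fun E => ?_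
  conv_lhs => rw [p.as_sum]
  rw [map_sum, coeff_sum, coeff_zero]
  simp only [h1, coeff_monomial]

theorem hibiIdeal_le_diagIdeal : hibiIdeal (PluckerIndex n) ≤ diagIdeal n := by
  unfold hibiIdeal
  rw [Ideal.span_le]
  rintro _ ⟨a, b, rfl⟩
  change aeval _ _ = _
  simp only [map_sub, map_mul, aeval_X, monomial_mul, mul_one]
  rw [add_comm (diagExp (a ⊔ b)), diagExp_inf_add_sup, sub_self]

/-- A variable weighs as much as the diagonal term of its minor. So in the lowest weight the
expansion of a Plücker relation contains products of diagonal terms only, and these must cancel. -/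
theorem initialPart_mem_diagIdeal {G : ℕ → ℕ → ℝ} (hG : StrictlyConvex G) (h0 : ∀ t, G t 0 = 0)
    {p : MvPolynomial (PluckerIndex n) ℂ} (hp : p ∈ pluckerIdeal n) :
    initialPart (pathWeight G) p ∈ diagIdeal n := by
  classical
  by_cases hz : p = 0
  · rw [hz, initialPart_zero]
    exact Ideal.zero_mem _
  set w : PluckerIndex n → ℝ := pathWeight G with hw
  have hw' : w = fun a => Finsupp.weight (entryWeight n G) (diagExp a) :=
    funext fun a => (weight_entryWeight G h0 a).symm
  obtain ⟨m₀, hm₀, hmin⟩ := exists_weight_min w hz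
  rw [mem_diagIdeal]
  intro E
  by_cases hE : Finsupp.weight (entryWeight n G) E = Finsupp.weight w m₀
  · refine Eq.trans (Finset.sum_subset_zero_on_sdiff (fun m hm =>
      ((mem_support_initialPart w hm₀ hmin m).1 hm).1) (fun m hm => ?_) (fun m hm => ?_))
      (sum_coeff_diagExp_eq_zero hG.diagWeight hp E
        (fun m hm => by rw [← hw', hE]; exact hmin m hm))
    · rw [Finset.mem_sdiff] at hm
      rw [if_neg]
      intro hmE
      refine hm.2 ((mem_support_initialPart w hm₀ hmin m).2 ⟨hm.1, ?_⟩)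
      rw [← hE, ← hmE, weight_weight, hw']
    · rw [coeff_initialPart w hm₀ hmin, if_pos ((mem_support_initialPart w hm₀ hmin m).1 hm).2]
  · refine Finset.sum_eq_zero fun m hm => if_neg fun hmE => hE ?_
    rw [← hmE, weight_weight, ← hw']
    exact ((mem_support_initialPart w hm₀ hmin m).1 hm).2

namespace IsNormalForm

variable {nf : (PluckerIndex n →₀ ℕ) → MvPolynomial (PluckerIndex n) ℂ} {w₀ : PluckerIndex n → ℝ}

/-- The terms of a straightening relation are products of two comparable variables. -/
theorem exists_pairExp (h : IsNormalForm nf w₀) {a b : PluckerIndex n} {q : PluckerIndex n →₀ ℕ}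
    (hq : q ∈ (nf (pairExp a b)).support) :
    ∃ c d, c ≤ d ∧ q = pairExp c d ∧ bidegree a + bidegree b = bidegree c + bidegree d := by
  have hn : 0 < n := a.len_pos.trans a.len_lt
  have h1 := h.bidegree_eq _ q hq
  have h2 : q.degree = 2 := by
    rw [← weight_bidegree_fst_zero q hn, h1, weight_bidegree_fst_zero _ hn]
    simp [pairExp]
  obtain ⟨c, d, hcd, rfl⟩ := exists_pairExp_of_degree h2 (h.standard _ q hq)
  rw [weight_pairExp, weight_pairExp] at h1
  exact ⟨c, d, hcd, rfl, h1.symm⟩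

/-- If the initial part of a straightening relation is a relation between diagonal terms, then it
is the Hibi relation. -/
theorem hibi_of_initialPart_mem (h : IsNormalForm nf w₀) {w : PluckerIndex n → ℝ}
    {a b : PluckerIndex n} (hab : ¬ a ≤ b) (hba : ¬ b ≤ a)
    (hw : initialPart w (monomial (pairExp a b) 1 - nf (pairExp a b)) ∈ diagIdeal n) :
    coeff (pairExp (a ⊓ b) (a ⊔ b)) (nf (pairExp a b)) = 1 ∧
      w (a ⊓ b) + w (a ⊔ b) = w a + w b ∧
      ∀ q ∈ (nf (pairExp a b)).support, q ≠ pairExp (a ⊓ b) (a ⊔ b) →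
        Finsupp.weight w (pairExp a b) < Finsupp.weight w q := by
  classical
  have hns := nonstandard_pairExp hab hba
  set p := monomial (pairExp a b) (1 : ℂ) - nf (pairExp a b) with hp
  have hmem := h.mem_support_sub_iff hns
  rw [← hp] at hmem
  have hpa : pairExp a b ∈ p.support := (hmem _).2 (Or.inl rfl)
  have hz : p ≠ 0 := support_nonempty.1 ⟨_, hpa⟩
  obtain ⟨m₀, hm₀, hmin⟩ := exists_weight_min w hz
  have hsupp := mem_support_initialPart w hm₀ hmin
  have hinj : ∀ q ∈ (nf (pairExp a b)).support, ∀ c d, c ≤ d →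
      Finsupp.weight diagExp q = diagExp c + diagExp d → q = pairExp c d := by
    intro q hq c d hcd hE
    obtain ⟨c', d', hcd', rfl, -⟩ := h.exists_pairExp hq
    rw [weight_pairExp] at hE
    obtain ⟨rfl, rfl⟩ := eq_of_diagExp_add_eq hcd' hcd hE
    rfl
  have hinj' : ∀ q ∈ (nf (pairExp a b)).support, ∀ q' ∈ (nf (pairExp a b)).support,
      Finsupp.weight diagExp q = Finsupp.weight diagExp q' → q = q' := by
    intro q hq q' hq' hE
    obtain ⟨c, d, hcd, rfl, -⟩ := h.exists_pairExp hq'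
    exact hinj q hq c d hcd (by rw [hE, weight_pairExp])
  rw [mem_diagIdeal] at hw
  -- In a relation between monomials no term is alone in its `diagExp` fibre. Standard pairs lie in
  -- different fibres, so every term shares the fibre of `X_a X_b`.
  have hfirst : ∀ q ∈ (initialPart w p).support,
      pairExp a b ∈ (initialPart w p).support ∧
        Finsupp.weight diagExp q = Finsupp.weight diagExp (pairExp a b) := by
    intro q hq
    by_contra hcon
    have h1 := hw (Finsupp.weight diagExp q)
    rw [Finset.sum_eq_single q] at h1
    · rw [if_pos rfl] at h1
      exact mem_support_iff.1 hq h1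
    · intro e he heq
      rw [if_neg]
      intro hE
      rcases (hmem e).1 ((hsupp e).1 he).1 with rfl | he'
      · exact hcon ⟨he, hE.symm⟩
      · rcases (hmem q).1 ((hsupp q).1 hq).1 with rfl | hq'
        · exact hcon ⟨hq, rfl⟩
        · exact heq (hinj' e he' q hq' hE)
    · exact fun h1 => absurd hq h1
  have hE : Finsupp.weight diagExp (pairExp a b) = diagExp (a ⊓ b) + diagExp (a ⊔ b) := by
    rw [weight_pairExp, diagExp_inf_add_sup]
  have hle : a ⊓ b ≤ a ⊔ b := inf_le_left.trans le_sup_left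
  have hm₀' := (hsupp m₀).2 ⟨hm₀, rfl⟩
  have habs := (hfirst m₀ hm₀').1
  have hwa := ((hsupp _).1 habs).2
  have hne : pairExp a b ≠ pairExp (a ⊓ b) (a ⊔ b) := fun h1 =>
    not_nonstandard_pairExp hle (h1 ▸ hns)
  have hself : coeff (pairExp a b) p = 1 := by
    rw [hp, coeff_sub, coeff_monomial, if_pos rfl,
      notMem_support_iff.1 (h.self_notMem_support hns), sub_zero]
  have hall : ∀ e ∈ (initialPart w p).support, e = pairExp a b ∨
      e = pairExp (a ⊓ b) (a ⊔ b) := by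
    intro e he
    rcases (hmem e).1 ((hsupp e).1 he).1 with rfl | he'
    · exact Or.inl rfl
    · exact Or.inr (hinj e he' _ _ hle ((hfirst e he).2.trans hE))
  have hsum := hw (Finsupp.weight diagExp (pairExp a b))
  have hsub : (initialPart w p).support ⊆ {pairExp a b, pairExp (a ⊓ b) (a ⊔ b)} := by
    intro e he
    simpa using hall e he
  rw [Finset.sum_subset hsub (fun e _ he => by rw [notMem_support_iff.1 he]; simp),
    Finset.sum_pair hne, if_pos rfl, if_pos (by rw [weight_pairExp, hE]),
    coeff_initialPart w hm₀ hmin, if_pos hwa, hself] at hsum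
  have hcoeff : coeff (pairExp (a ⊓ b) (a ⊔ b)) (initialPart w p) ≠ 0 := by
    intro h1
    rw [h1, add_zero] at hsum
    exact one_ne_zero hsum
  have hmem2 := (hsupp _).1 (mem_support_iff.2 hcoeff)
  refine ⟨?_, ?_, fun q hq hqne => ?_⟩
  · rw [coeff_initialPart w hm₀ hmin, if_pos hmem2.2, hp, coeff_sub, coeff_monomial,
      if_neg hne, zero_sub] at hsum
    linear_combination -hsum
  · have h1 := hmem2.2.trans hwa.symm
    rwa [weight_pairExp, weight_pairExp] at h1
  · have hqp := (hmem q).2 (Or.inr hq)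
    refine lt_of_le_of_ne (hwa.trans_le (hmin q hqp)) fun h1 => ?_
    rcases hall q ((hsupp q).2 ⟨hqp, h1.symm.trans hwa⟩) with rfl | h2
    · exact h.self_notMem_support hns hq
    · exact hqne h2

/-- The conditions on a valuation which put it into the Gröbner cone of the Hibi ideal. -/
theorem mem_cone_hibi (h : IsNormalForm nf w₀) {w : PluckerIndex n → ℝ}
    (hval : ∀ a b, w a + w b = w (a ⊓ b) + w (a ⊔ b))
    (hone : ∀ a b : PluckerIndex n, ¬ a ≤ b → ¬ b ≤ a →
      coeff (pairExp (a ⊓ b) (a ⊔ b)) (nf (pairExp a b)) = 1)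
    (hlt : ∀ a b, ¬ a ≤ b → ¬ b ≤ a → ∀ q ∈ (nf (pairExp a b)).support,
      q ≠ pairExp (a ⊓ b) (a ⊔ b) → Finsupp.weight w (pairExp a b) < Finsupp.weight w q) :
    w ∈ groebnerCone (pluckerIdeal n) (hibiIdeal (PluckerIndex n)) := by
  classical
  have hval' : ∀ a b, Finsupp.weight w (pairExp (a ⊓ b) (a ⊔ b)) =
      Finsupp.weight w (pairExp a b) := fun a b => by
    rw [weight_pairExp, weight_pairExp, hval a b]
  have hweak : Weak nf w := by
    intro a b hab hba q hq
    by_cases hqe : q = pairExp (a ⊓ b) (a ⊔ b)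
    · rw [hqe, hval']
    · exact (hlt a b hab hba q hq hqe).le
  have hgen : ∀ a b, monomial (pairExp a b) (1 : ℂ) - monomial (pairExp (a ⊓ b) (a ⊔ b)) 1 ∈
      hibiIdeal (PluckerIndex n) := fun a b => Ideal.subset_span ⟨a, b, by
    rw [monomial_pairExp, pairExp_comm, monomial_pairExp]⟩
  -- Modulo the Hibi ideal each monomial equals a standard monomial of the same weight, and this one
  -- is the lowest term of its normal form.
  have hstd : ∀ m, ∃ s, ¬ Nonstandard s ∧ Finsupp.weight w s = Finsupp.weight w m ∧
      monomial m (1 : ℂ) - monomial s 1 ∈ hibiIdeal (PluckerIndex n) ∧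
      ∀ q ∈ (nf m - monomial s 1).support, Finsupp.weight w m < Finsupp.weight w q := by
    intro m
    induction m using heavier_induction w₀ with
    | h m ih =>
    by_cases hm : Nonstandard m
    · obtain ⟨u, a, b, hab, hba, rfl⟩ := exists_add_pairExp hm
      set r := pairExp (a ⊓ b) (a ⊔ b) with hr
      have hrs : r ∈ (nf (pairExp a b)).support := by
        rw [mem_support_iff, hone a b hab hba]
        exact one_ne_zero
      obtain ⟨s, hs1, hs2, hs3, hs4⟩ := ih (u + r)
        (by rw [map_add, map_add, h.bidegree_eq _ r hrs])
        (by
          rw [map_add, map_add]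
          have := h.weight_lt _ (nonstandard_pairExp hab hba) r hrs
          linarith)
      have hur : Finsupp.weight w (u + r) = Finsupp.weight w (u + pairExp a b) := by
        rw [map_add, map_add, hr, hval']
      refine ⟨s, hs1, hs2.trans hur, ?_, ?_⟩
      · have h1 : monomial (u + pairExp a b) (1 : ℂ) - monomial s 1 =
            monomial u 1 * (monomial (pairExp a b) 1 - monomial r 1) +
              (monomial (u + r) 1 - monomial s 1) := by
          rw [mul_sub, monomial_mul, monomial_mul, one_mul]
          ring
        rw [h1]
        exact Ideal.add_mem _ (Ideal.mul_mem_left _ _ (hgen a b)) hs3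
      · intro q hq
        rw [h.add_eq, ← Finset.add_sum_erase _ _ hrs, hone a b hab hba, one_smul,
          add_sub_right_comm] at hq
        rcases Finset.mem_union.1 (support_add hq) with hq | hq
        · rw [← hur]
          exact hs4 q hq
        · obtain ⟨e, he, heq⟩ := Finset.mem_biUnion.1 (support_sum hq)
          rw [Finset.mem_erase] at he
          refine lt_of_lt_of_le ?_ (h.weight_le hweak _ q (support_smul heq))
          rw [map_add, map_add]
          have := hlt a b hab hba e he.2 he.1
          linarith
    · refine ⟨m, hm, rfl, ?_, ?_⟩
      · rw [sub_self]
        exact Ideal.zero_mem _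
      · rw [h.of_standard hm, sub_self]
        simp
  choose std hstd1 hstd2 hstd3 hstd4 using hstd
  rw [mem_groebnerCone]
  intro q
  constructor
  · intro hq
    refine (Submodule.span_le (p := (hibiIdeal (PluckerIndex n)).restrictScalars ℂ)).2 ?_ hq
    rintro _ ⟨p, hp, rfl⟩
    change initialPart w p ∈ hibiIdeal (PluckerIndex n)
    by_cases h0 : p = 0
    · rw [h0, initialPart_zero]
      exact Ideal.zero_mem _
    obtain ⟨m₀, hm₀, hmin⟩ := exists_weight_min w h0
    have hsupp := mem_support_initialPart w hm₀ hmin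
    -- This is the lowest-weight part of the vanishing combination of normal forms.
    have hzero : ∑ m ∈ (initialPart w p).support,
        coeff m (initialPart w p) • monomial (std m) (1 : ℂ) = 0 := by
      ext e
      rw [coeff_sum, coeff_zero]
      by_cases he : Finsupp.weight w e = Finsupp.weight w m₀
      · have h1 := congrArg (coeff e) (h.sum_eq_zero hp)
        rw [coeff_sum, coeff_zero] at h1
        rw [← h1]
        refine Finset.sum_subset_zero_on_sdiff (fun m hm => ((hsupp m).1 hm).1)
          (fun m hm => ?_) (fun m hm => ?_)
        · rw [Finset.mem_sdiff] at hm
          have hmw : Finsupp.weight w m ≠ Finsupp.weight w m₀ := fun h2 =>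
            hm.2 ((hsupp m).2 ⟨hm.1, h2⟩)
          rw [coeff_smul, smul_eq_mul, mul_eq_zero]
          right
          by_contra hne
          have h2 := h.weight_le hweak m e (mem_support_iff.2 hne)
          have h3 := hmin m hm.1
          exact hmw (le_antisymm (h2.trans_eq he) h3)
        · have hmw := ((hsupp m).1 hm).2
          have h2 : coeff e (nf m - monomial (std m) 1) = 0 := by
            by_contra hne
            have h3 := hstd4 m e (mem_support_iff.2 hne)
            rw [he, hmw] at h3
            exact lt_irrefl _ h3
          rw [coeff_sub, sub_eq_zero] at h2
          rw [coeff_smul, coeff_smul, h2, coeff_initialPart w hm₀ hmin, if_pos hmw]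
      · refine Finset.sum_eq_zero fun m hm => ?_
        have hmw := ((hsupp m).1 hm).2
        rw [coeff_smul, coeff_monomial, if_neg, smul_zero]
        rintro rfl
        exact he ((hstd2 m).trans hmw)
    have h1 : initialPart w p = ∑ m ∈ (initialPart w p).support,
        coeff m (initialPart w p) • (monomial m (1 : ℂ) - monomial (std m) 1) := by
      simp only [smul_sub, Finset.sum_sub_distrib]
      rw [hzero, sub_zero]
      simp only [smul_monomial, smul_eq_mul, mul_one]
      exact (initialPart w p).as_sum
    rw [h1]
    exact Ideal.sum_mem _ fun m _ => Submodule.smul_of_tower_mem _ _ (hstd3 m)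
  · have hmono : ∀ (u : PluckerIndex n →₀ ℕ) (a b : PluckerIndex n),
        monomial u (1 : ℂ) * (X a * X b - X (a ⊔ b) * X (a ⊓ b)) ∈
          initialSpan w (pluckerIdeal n) := by
      intro u a b
      by_cases hab : a ≤ b
      · rw [sup_eq_right.2 hab, inf_eq_left.2 hab, mul_comm (X b), sub_self, mul_zero]
        exact Submodule.zero_mem _
      by_cases hba : b ≤ a
      · rw [sup_eq_left.2 hba, inf_eq_right.2 hba, sub_self, mul_zero]
        exact Submodule.zero_mem _
      set r := pairExp (a ⊓ b) (a ⊔ b) with hr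
      have hns := nonstandard_pairExp hab hba
      have hle : a ⊓ b ≤ a ⊔ b := inf_le_left.trans le_sup_left
      have hne : pairExp a b ≠ r := fun h1 =>
        not_nonstandard_pairExp hle (h1 ▸ hns : Nonstandard r)
      set p := monomial (pairExp a b) (1 : ℂ) - nf (pairExp a b) with hp
      have hmem := h.mem_support_sub_iff hns
      rw [← hp] at hmem
      have hcoeff : ∀ e, coeff (u + e) (monomial u 1 * p) = coeff e p := fun e => by
        rw [coeff_monomial_mul, one_mul]
      have hsupp : ∀ e ∈ (monomial u 1 * p).support, ∃ e' ∈ p.support, e = u + e' := by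
        intro e he
        rw [mem_support_iff, coeff_monomial_mul'] at he
        split_ifs at he with hue
        · obtain ⟨e', rfl⟩ := exists_add_of_le hue
          rw [add_tsub_cancel_left, one_mul] at he
          exact ⟨e', mem_support_iff.2 he, rfl⟩
        · exact absurd rfl he
      have hpa : u + pairExp a b ∈ (monomial u 1 * p).support := by
        rw [mem_support_iff, hcoeff, ← mem_support_iff]
        exact (hmem _).2 (Or.inl rfl)
      have hmin : ∀ e ∈ (monomial u 1 * p).support,
          Finsupp.weight w (u + pairExp a b) ≤ Finsupp.weight w e := by
        intro e he
        obtain ⟨e', he', rfl⟩ := hsupp e he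
        rw [map_add, map_add]
        rcases (hmem e').1 he' with rfl | h1
        · exact le_rfl
        · have := hweak a b hab hba e' h1
          linarith
      have hin : initialPart w (monomial u 1 * p) =
          monomial u (1 : ℂ) * (X a * X b - X (a ⊔ b) * X (a ⊓ b)) := by
        rw [← monomial_pairExp, ← monomial_pairExp, pairExp_comm (a ⊔ b), ← hr]
        ext e
        rw [coeff_initialPart w hpa hmin, coeff_monomial_mul', coeff_monomial_mul']
        by_cases hue : u ≤ e
        · obtain ⟨e', rfl⟩ := exists_add_of_le hue
          rw [if_pos hue, if_pos hue, add_tsub_cancel_left, one_mul, one_mul, map_add, map_add]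
          simp only [add_right_inj]
          rw [hp, coeff_sub, coeff_sub, coeff_monomial, coeff_monomial]
          by_cases h1 : pairExp a b = e'
          · subst h1
            rw [if_pos rfl, if_pos rfl, if_neg hne.symm,
              notMem_support_iff.1 (h.self_notMem_support hns)]
          · rw [if_neg h1]
            by_cases h2 : r = e'
            · subst h2
              rw [if_pos (hval' a b), if_pos rfl, hone a b hab hba]
            · rw [if_neg h2]
              by_cases h3 : e' ∈ (nf (pairExp a b)).support
              · rw [if_neg (hlt a b hab hba e' h3 (Ne.symm h2)).ne', sub_zero]
              · rw [notMem_support_iff.1 h3]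
                simp
        · rw [if_neg hue, if_neg hue]
          simp
      rw [← hin]
      exact initialPart_mem_initialSpan w (Ideal.mul_mem_left _ _ (h.sub_mem _))
    intro hq
    -- `initialSpan` is defined as a linear span only, so the induction carries an arbitrary
    -- multiplier.
    have hall : ∀ r, r * q ∈ initialSpan w (pluckerIdeal n) := by
      refine Submodule.span_induction
        (p := fun q _ => ∀ r, r * q ∈ initialSpan w (pluckerIdeal n)) ?_ ?_ ?_ ?_ hq
      · rintro _ ⟨a, b, rfl⟩ r
        rw [r.as_sum, Finset.sum_mul]
        refine Submodule.sum_mem _ fun u _ => ?_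
        have h1 := Submodule.smul_mem _ (coeff u r) (hmono u a b)
        rwa [← smul_mul_assoc, smul_monomial, smul_eq_mul, mul_one] at h1
      · intro r
        rw [mul_zero]
        exact Submodule.zero_mem _
      · intro x y _ _ hx hy r
        rw [mul_add]
        exact Submodule.add_mem _ (hx r) (hy r)
      · intro c x _ hx r
        rw [smul_eq_mul, ← mul_assoc]
        exact hx (r * c)
    simpa using hall 1

end IsNormalForm

end PluckerIndex

/-! ### Polyhedral cones -/

section Polyhedral

open Filter Topology

variable {V : Type*} [AddCommGroup V] [Module ℝ V]

theorem exists_pos_forall_nonneg {ι : Type*} [Finite ι] (ℓ : ι → Module.Dual ℝ V) (w v : V)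
    (h : ∀ i, 0 < ℓ i w ∨ (ℓ i w = 0 ∧ ℓ i v = 0)) :
    ∃ ε : ℝ, 0 < ε ∧ ∀ i, 0 ≤ ℓ i (w + ε • v) := by
  have h1 : ∀ i, ∀ᶠ ε : ℝ in 𝓝[>] 0, 0 ≤ ℓ i (w + ε • v) := by
    intro i
    rcases h i with h2 | ⟨h2, h3⟩
    · have hc : Tendsto (fun ε : ℝ => ℓ i w + ε * ℓ i v) (𝓝[>] 0) (𝓝 (ℓ i w + 0 * ℓ i v)) :=
        ((continuous_const.add (continuous_id.mul continuous_const)).tendsto _).mono_left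
          nhdsWithin_le_nhds
      rw [zero_mul, add_zero] at hc
      filter_upwards [hc.eventually (lt_mem_nhds h2)] with ε hε
      rw [map_add, map_smul, smul_eq_mul]
      exact hε.le
    · filter_upwards with ε
      rw [map_add, map_smul, h2, h3]
      simp
  obtain ⟨ε, hε, hpos⟩ := ((eventually_all.2 h1).and self_mem_nhdsWithin).exists
  exact ⟨ε, hpos, hε⟩

theorem vectorSpan_eq_of_core {S : Set V} {H : Submodule ℝ V} (hS : ∀ x ∈ S, x ∈ H) {w : V}
    (hw : w ∈ S) (h : ∀ v ∈ H, ∃ ε : ℝ, 0 < ε ∧ w + ε • v ∈ S) : vectorSpan ℝ S = H := by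
  apply le_antisymm
  · rw [vectorSpan_def, Submodule.span_le]
    rintro _ ⟨x, hx, y, hy, rfl⟩
    exact H.sub_mem (hS x hx) (hS y hy)
  · intro v hv
    obtain ⟨ε, hε, hmem⟩ := h v hv
    have h1 := Submodule.smul_mem _ ε⁻¹ (vsub_mem_vectorSpan ℝ hmem hw)
    rwa [vsub_eq_sub, add_sub_cancel_left, smul_smul, inv_mul_cancel₀ hε.ne', one_smul] at h1

variable [TopologicalSpace V] [FiniteDimensional ℝ V]

/-- A facet of a full-dimensional polyhedral cone is cut out by one of the inequalities, and has a
point at which all tight inequalities are proportional to this one. -/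
theorem IsFacet.exists_inequality {ι : Type*} [Finite ι] (ℓ : ι → Module.Dual ℝ V) {w : V}
    (hpos : ∀ i, 0 < ℓ i w) {F : Set V} (hF : IsFacet F {x | ∀ i, 0 ≤ ℓ i x}) :
    ∃ i₀, F = {x | (∀ i, 0 ≤ ℓ i x) ∧ ℓ i₀ x = 0} ∧
      ∃ w' ∈ F, ∀ j, ℓ j w' = 0 → ∃ s : ℝ, 0 < s ∧ ℓ j = s • ℓ i₀ := by
  classical
  obtain ⟨hne, hexp, hdim⟩ := hF
  obtain ⟨l, hl⟩ := hexp hne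
  have hC0 : ∀ i, 0 ≤ ℓ i (0 : V) := fun i => by rw [map_zero]
  obtain ⟨x₀, hx₀⟩ := hne
  have hx₀' := hx₀
  rw [hl] at hx₀'
  -- Both `0` and `2 • x₀` lie in the cone, so the maximum of `l` is zero.
  have hmax0 : l x₀ = 0 := by
    have h1 := hx₀'.2 0 hC0
    have h2 := hx₀'.2 ((2 : ℝ) • x₀) fun i => by
      rw [map_smul, smul_eq_mul]
      exact mul_nonneg two_pos.le (hx₀'.1 i)
    rw [map_zero] at h1
    rw [map_smul, smul_eq_mul] at h2
    linarith
  have hle : ∀ y, (∀ i, 0 ≤ ℓ i y) → l y ≤ 0 := fun y hy => hmax0 ▸ hx₀'.2 y hy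
  have hmemF : ∀ x, x ∈ F ↔ (∀ i, 0 ≤ ℓ i x) ∧ l x = 0 := by
    intro x
    rw [hl]
    constructor
    · rintro ⟨hx, hx'⟩
      refine ⟨hx, le_antisymm (hle x hx) ?_⟩
      have := hx' 0 hC0
      rwa [map_zero] at this
    · rintro ⟨hx, hx'⟩
      exact ⟨hx, fun y hy => hx' ▸ hle y hy⟩
  have hspan : vectorSpan ℝ {x : V | ∀ i, 0 ≤ ℓ i x} = ⊤ := by
    refine vectorSpan_eq_of_core (fun x _ => Submodule.mem_top) (w := w)
      (fun i => (hpos i).le) ?_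
    intro v _
    exact exists_pos_forall_nonneg ℓ w v fun i => Or.inl (hpos i)
  rw [hspan, finrank_top] at hdim
  have hl0 : (l : V →ₗ[ℝ] ℝ) ≠ 0 := by
    intro h
    have h1 : F = {x : V | ∀ i, 0 ≤ ℓ i x} := by
      ext x
      rw [hmemF]
      exact ⟨fun hx => hx.1, fun hx => ⟨hx, LinearMap.congr_fun h x⟩⟩
    rw [h1, hspan, finrank_top] at hdim
    omega
  -- The sum of these points serves as a relative interior point of `F`: an inequality tight there
  -- is tight on all of `F`.
  have hpt : ∀ i, ∃ x ∈ F, 0 < ℓ i x ∨ ∀ y ∈ F, ℓ i y = 0 := by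
    intro i
    by_cases h : ∃ x ∈ F, 0 < ℓ i x
    · obtain ⟨x, hx, hxi⟩ := h
      exact ⟨x, hx, Or.inl hxi⟩
    · push Not at h
      exact ⟨x₀, hx₀, Or.inr fun y hy => le_antisymm (h y hy) (((hmemF y).1 hy).1 i)⟩
  choose p hpF hp using hpt
  have := Fintype.ofFinite ι
  have hw'F : ∑ i, p i ∈ F := by
    rw [hmemF]
    refine ⟨fun i => ?_, ?_⟩
    · rw [map_sum]
      exact Finset.sum_nonneg fun j _ => ((hmemF _).1 (hpF j)).1 i
    · rw [map_sum]
      exact Finset.sum_eq_zero fun j _ => ((hmemF _).1 (hpF j)).2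
  have htight : ∀ j, ℓ j (∑ i, p i) = 0 → ∀ y ∈ F, ℓ j y = 0 := by
    intro j hj
    rcases hp j with h | h
    · exfalso
      rw [map_sum] at hj
      have h1 := (Finset.sum_eq_zero_iff_of_nonneg
        fun k _ => ((hmemF _).1 (hpF k)).1 j).1 hj j (Finset.mem_univ _)
      exact h.ne' h1
    · exact h
  -- The directions of `F` form a hyperplane, hence the kernel of any nonzero functional vanishing
  -- on `F`.
  have hspanF : ∀ g : Module.Dual ℝ V, g ≠ 0 → (∀ y ∈ F, g y = 0) →
      vectorSpan ℝ F = LinearMap.ker g := by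
    intro g hg hgF
    refine Submodule.eq_of_le_of_finrank_eq ?_ ?_
    · rw [vectorSpan_def, Submodule.span_le]
      rintro _ ⟨x, hx, y, hy, rfl⟩
      change g (x - y) = 0
      rw [map_sub, hgF x hx, hgF y hy, sub_zero]
    · have := Module.Dual.finrank_ker_add_one_of_ne_zero hg
      omega
  have hℓ0 : ∀ i, ℓ i ≠ 0 := fun i h => by
    have := hpos i
    rw [h] at this
    exact lt_irrefl _ this
  have hker : ∀ j, ℓ j (∑ i, p i) = 0 → LinearMap.ker (ℓ j) = LinearMap.ker (l : V →ₗ[ℝ] ℝ) :=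
    fun j hj => (hspanF _ (hℓ0 j) (htight j hj)).symm.trans
      (hspanF (l : V →ₗ[ℝ] ℝ) hl0 fun y hy => ((hmemF y).1 hy).2)
  -- Otherwise `l` would attain its maximum at an interior point of the cone and vanish.
  obtain ⟨i₀, hi₀⟩ : ∃ i₀, ℓ i₀ (∑ i, p i) = 0 := by
    by_contra hcon
    push Not at hcon
    refine hl0 (LinearMap.ext fun v => ?_)
    have hneg : ∀ v, l v ≤ 0 := by
      intro v
      obtain ⟨ε, hε, hall⟩ := exists_pos_forall_nonneg ℓ (∑ i, p i) v fun i =>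
        Or.inl (lt_of_le_of_ne (((hmemF _).1 hw'F).1 i) (Ne.symm (hcon i)))
      have h1 := hle _ hall
      rw [map_add, map_smul, ((hmemF _).1 hw'F).2, zero_add, smul_eq_mul] at h1
      by_contra h2
      push Not at h2
      have := mul_pos hε h2
      linarith
    have h1 := hneg v
    have h2 := hneg (-v)
    rw [map_neg] at h2
    change l v = 0
    exact le_antisymm h1 (by linarith)
  refine ⟨i₀, ?_, ∑ i, p i, hw'F, fun j hj => ?_⟩
  · ext x
    rw [hmemF]
    have h1 : ℓ i₀ x = 0 ↔ l x = 0 := by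
      have := SetLike.ext_iff.1 (hker i₀ hi₀) x
      exact this
    exact ⟨fun hx => ⟨hx.1, h1.2 hx.2⟩, fun hx => ⟨hx.1, h1.1 hx.2⟩⟩
  · have h1 : LinearMap.ker (ℓ i₀) = LinearMap.ker (ℓ j) := (hker i₀ hi₀).trans (hker j hj).symm
    have hw0 := hpos i₀
    refine ⟨ℓ j w / ℓ i₀ w, div_pos (hpos j) hw0, LinearMap.ext fun v => ?_⟩
    have h2 : v - (ℓ i₀ v / ℓ i₀ w) • w ∈ LinearMap.ker (ℓ i₀) := by
      rw [LinearMap.mem_ker, map_sub, map_smul, smul_eq_mul, div_mul_cancel₀ _ hw0.ne', sub_self]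
    rw [h1, LinearMap.mem_ker, map_sub, map_smul, smul_eq_mul, sub_eq_zero] at h2
    rw [h2, LinearMap.smul_apply, smul_eq_mul]
    ring

variable [IsTopologicalAddGroup V] [ContinuousSMul ℝ V] [T2Space V]

/-- The closure of a nonempty set given by strict linear inequalities in a subspace. -/
theorem closure_strict_cone {ι : Type*} (H : Submodule ℝ V) (ℓ : ι → Module.Dual ℝ V) {w : V}
    (hw : w ∈ H) (hpos : ∀ i, 0 < ℓ i w) :
    closure {x | x ∈ H ∧ ∀ i, 0 < ℓ i x} = {x | x ∈ H ∧ ∀ i, 0 ≤ ℓ i x} := by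
  apply Set.Subset.antisymm
  · refine closure_minimal (fun x hx => ⟨hx.1, fun i => (hx.2 i).le⟩) ?_
    refine IsClosed.inter H.closed_of_finiteDimensional ?_
    have h1 : {x : V | ∀ i, 0 ≤ ℓ i x} = ⋂ i, {x | 0 ≤ ℓ i x} := by
      ext x
      simp
    change IsClosed {x : V | ∀ i, 0 ≤ ℓ i x}
    rw [h1]
    exact isClosed_iInter fun i => isClosed_le continuous_const
      (LinearMap.continuous_of_finiteDimensional (ℓ i))
  · rintro x ⟨hx, hx'⟩
    have hc : Tendsto (fun ε : ℝ => x + ε • w) (𝓝[>] 0) (𝓝 (x + (0 : ℝ) • w)) :=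
      ((continuous_const.add (continuous_id.smul continuous_const)).tendsto _).mono_left
        nhdsWithin_le_nhds
    rw [zero_smul, add_zero] at hc
    refine mem_closure_of_tendsto hc ?_
    filter_upwards [self_mem_nhdsWithin] with ε hε
    refine ⟨H.add_mem hx (H.smul_mem _ hw), fun i => ?_⟩
    rw [map_add, map_smul, smul_eq_mul]
    have := mul_pos (show (0 : ℝ) < ε from hε) (hpos i)
    have := hx' i
    linarith

/-- A linear inequality cuts out a facet if some point of the cone satisfies with equality only
those inequalities which are implied by it. -/
theorem isFacet_of_tight {ι : Type*} [Finite ι] (H : Submodule ℝ V) (ℓ : ι → Module.Dual ℝ V)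
    {w w' : V} (hw : w ∈ H) (hpos : ∀ i, 0 < ℓ i w) (i₀ : ι) (hw' : w' ∈ H)
    (h0 : ℓ i₀ w' = 0)
    (htight : ∀ i, 0 < ℓ i w' ∨ ∀ v ∈ H, ℓ i₀ v = 0 → ℓ i v = 0) :
    IsFacet {x | (x ∈ H ∧ ∀ i, 0 ≤ ℓ i x) ∧ ℓ i₀ x = 0} {x | x ∈ H ∧ ∀ i, 0 ≤ ℓ i x} := by
  have hw'' : ∀ i, 0 ≤ ℓ i w' := fun i => by
    rcases htight i with h | h
    · exact h.le
    · exact (h w' hw' h0).ge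
  refine ⟨⟨w', ⟨hw', hw''⟩, h0⟩, fun _ => ⟨LinearMap.toContinuousLinearMap (-(ℓ i₀)), ?_⟩, ?_⟩
  · ext x
    simp only [Set.mem_ofPred_eq, LinearMap.coe_toContinuousLinearMap', LinearMap.neg_apply,
      neg_le_neg_iff]
    constructor
    · rintro ⟨hx, hx0⟩
      exact ⟨hx, fun y hy => by rw [hx0]; exact hy.2 i₀⟩
    · rintro ⟨hx, hx0⟩
      refine ⟨hx, le_antisymm ?_ (hx.2 i₀)⟩
      have := hx0 w' ⟨hw', hw''⟩
      rwa [h0] at this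
  · have hspan : vectorSpan ℝ {x | x ∈ H ∧ ∀ i, 0 ≤ ℓ i x} = H := by
      refine vectorSpan_eq_of_core (fun x hx => hx.1) (w := w) ⟨hw, fun i => (hpos i).le⟩ ?_
      intro v hv
      obtain ⟨ε, hε, hall⟩ := exists_pos_forall_nonneg ℓ w v fun i => Or.inl (hpos i)
      exact ⟨ε, hε, H.add_mem hw (H.smul_mem _ hv), hall⟩
    have hspan' : vectorSpan ℝ {x | (x ∈ H ∧ ∀ i, 0 ≤ ℓ i x) ∧ ℓ i₀ x = 0} =
        H ⊓ LinearMap.ker (ℓ i₀) := by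
      refine vectorSpan_eq_of_core (fun x hx => ⟨hx.1.1, hx.2⟩) (w := w') ⟨⟨hw', hw''⟩, h0⟩ ?_
      rintro v ⟨hv, hv0⟩
      have hv0' : ℓ i₀ v = 0 := hv0
      obtain ⟨ε, hε, hall⟩ := exists_pos_forall_nonneg ℓ w' v fun i =>
        (htight i).imp id fun h => ⟨h w' hw' h0, h v hv hv0'⟩
      refine ⟨ε, hε, ⟨H.add_mem hw' (H.smul_mem _ hv), hall⟩, ?_⟩
      rw [map_add, map_smul, h0, hv0', smul_zero, add_zero]
    rw [hspan, hspan']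
    have hne : (ℓ i₀).comp H.subtype ≠ 0 := fun h => by
      have := LinearMap.congr_fun h ⟨w, hw⟩
      exact (hpos i₀).ne' this
    rw [← Module.Dual.finrank_ker_add_one_of_ne_zero hne, LinearMap.ker_comp,
      ← Submodule.map_comap_subtype, LinearEquiv.finrank_eq
        (Submodule.equivMapOfInjective H.subtype H.injective_subtype _).symm]

end Polyhedral

/-! ### Facets of the two Gröbner cones -/

/-- The weight of a fixed monomial, as a linear functional of the weights of the variables. -/
noncomputable def weightFunctional {σ : Type*} (m : σ →₀ ℕ) : Module.Dual ℝ (σ → ℝ) :=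
  ∑ a ∈ m.support, (m a : ℝ) • LinearMap.proj a

theorem weightFunctional_apply {σ : Type*} (m : σ →₀ ℕ) (w : σ → ℝ) :
    weightFunctional m w = Finsupp.weight w m := by
  simp [weightFunctional, Finsupp.weight_apply, Finsupp.sum]

theorem weight_single_one {σ : Type*} [DecidableEq σ] (m : σ →₀ ℕ) (x : σ) :
    Finsupp.weight (Pi.single x (1 : ℝ) : σ → ℝ) m = m x := by
  rw [Finsupp.weight_single_index, nsmul_eq_mul, mul_one]

namespace PluckerIndex

open MvPolynomial

variable {n : ℕ}

/-- The space of valuations on the lattice of Plücker indices. -/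
def valuations (n : ℕ) : Submodule ℝ (PluckerIndex n → ℝ) where
  carrier := {w | ∀ a b, w a + w b = w (a ⊓ b) + w (a ⊔ b)}
  zero_mem' := fun _ _ => rfl
  add_mem' := fun {v w} hv hw a b => by
    simp only [Pi.add_apply]
    linarith [hv a b, hw a b]
  smul_mem' := fun c w hw a b => by
    simp only [Pi.smul_apply, smul_eq_mul]
    rw [← mul_add, ← mul_add, hw a b]

theorem pathWeight_mem_valuations (G : ℕ → ℕ → ℝ) :
    (pathWeight G : PluckerIndex n → ℝ) ∈ valuations n :=
  fun a b => (pathWeight_inf_add_sup G a b).symm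

theorem weight_pathWeight_sub (G : ℕ → ℕ → ℝ) (a b c d : PluckerIndex n) :
    Finsupp.weight (pathWeight G) (pairExp c d) - Finsupp.weight (pathWeight G) (pairExp a b) =
      ∑ t ∈ Finset.range n, (G t (c.count (t + 1)) + G t (d.count (t + 1)) -
        G t (a.count (t + 1)) - G t (b.count (t + 1))) := by
  rw [weight_pairExp, weight_pairExp]
  unfold pathWeight
  simp only [Finset.sum_sub_distrib, Finset.sum_add_distrib]
  ring

theorem strictlyConvex_sq : StrictlyConvex fun _ m => (m : ℝ) ^ 2 := by
  intro t m
  push_cast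
  nlinarith

/-- A linear inequality between two pairs whose paths differ at a single point only is given by
a second difference there. -/
theorem weight_pathWeight_sub_of_single {a b c d : PluckerIndex n}
    (hsum : ∀ t ≤ n, a.count t + b.count t = c.count t + d.count t) {s m : ℕ} (hs : s < n)
    (ha : a.count (s + 1) = m) (hb : b.count (s + 1) = m) (hc : c.count (s + 1) = m + 1)
    (hmax : ∀ t ≤ n, t ≠ s + 1 → c.count t = max (a.count t) (b.count t)) (G : ℕ → ℕ → ℝ) :
    Finsupp.weight (pathWeight G) (pairExp c d) - Finsupp.weight (pathWeight G) (pairExp a b) =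
      G s (m + 1) + G s (m - 1) - 2 * G s m := by
  rw [weight_pathWeight_sub, Finset.sum_eq_single s]
  · have h1 := hsum (s + 1) (by omega)
    rw [ha, hb, hc, show d.count (s + 1) = m - 1 by omega]
    ring
  · intro t ht hts
    have ht' := Finset.mem_range.1 ht
    have h1 := hsum (t + 1) (by omega)
    have h2 := hmax (t + 1) (by omega) (by omega)
    rcases le_total (a.count (t + 1)) (b.count (t + 1)) with h | h
    · rw [h2, max_eq_right h, show d.count (t + 1) = a.count (t + 1) by omega]
      ring
    · rw [h2, max_eq_left h, show d.count (t + 1) = b.count (t + 1) by omega]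
      ring
  · exact fun h => absurd (Finset.mem_range.2 hs) h

/-- Squares, made flat at the single point `m` of the sequence with index `s`. -/
noncomputable def flatSquares (s m t x : ℕ) : ℝ :=
  (x : ℝ) ^ 2 - if t = s then |(x : ℝ) - m| - m else 0

/-- For `A ≥ B` write `C = A + k`, `B = D + k`, `A = B + j`. The squares contribute `2k(j + k)` and
the absolute values take away at most `2k`. Equality leaves `k = 0`, or `k = 1` and `j = 0` with the
kink at `A = B = m`. -/
theorem flatSquares_gap {s m t A B C D : ℕ} (hsum : A + B = C + D) (hA : A ≤ C) (hB : B ≤ C) :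
    0 ≤ flatSquares s m t C + flatSquares s m t D - flatSquares s m t A - flatSquares s m t B ∧
    (flatSquares s m t C + flatSquares s m t D - flatSquares s m t A - flatSquares s m t B = 0 →
      C = max A B ∨ (t = s ∧ A = m ∧ B = m ∧ C = m + 1)) := by
  wlog hAB : B ≤ A generalizing A B
  · have := this (A := B) (B := A) (by omega) hB hA (by omega)
    rw [max_comm]
    refine ⟨by linarith [this.1], fun h => ?_⟩
    rcases this.2 (by linarith) with h1 | ⟨h1, h2, h3, h4⟩
    · exact Or.inl h1
    · exact Or.inr ⟨h1, h3, h2, h4⟩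
  obtain ⟨k, rfl⟩ := exists_add_of_le hA
  obtain rfl : B = D + k := by omega
  obtain ⟨j, rfl⟩ := exists_add_of_le hAB
  rw [max_eq_left hAB]
  have hbase : ((D + k + j + k : ℕ) : ℝ) ^ 2 + (D : ℝ) ^ 2 - ((D + k + j : ℕ) : ℝ) ^ 2 -
      ((D + k : ℕ) : ℝ) ^ 2 = 2 * k * (j + k) := by
    push_cast
    ring
  have hk0 : (0 : ℝ) ≤ k := Nat.cast_nonneg k
  have hj0 : (0 : ℝ) ≤ j := Nat.cast_nonneg j
  unfold flatSquares
  by_cases hts : t = s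
  · simp only [if_pos hts]
    have habs1 : |((D + k + j + k : ℕ) : ℝ) - m| ≤ |((D + k + j : ℕ) : ℝ) - m| + k := by
      have := abs_add_le (((D + k + j : ℕ) : ℝ) - m) (k : ℝ)
      rw [abs_of_nonneg hk0] at this
      refine le_trans (le_of_eq ?_) this
      congr 1
      push_cast
      ring
    have habs2 : |(D : ℝ) - m| ≤ |((D + k : ℕ) : ℝ) - m| + k := by
      have := abs_sub (((D + k : ℕ) : ℝ) - m) (k : ℝ)
      rw [abs_of_nonneg hk0] at this
      refine le_trans (le_of_eq ?_) this
      congr 1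
      push_cast
      ring
    rcases Nat.eq_zero_or_pos k with rfl | hkpos
    · simp only [add_zero]
      refine ⟨le_of_eq (by ring), fun _ => Or.inl trivial⟩
    · have hk1 : (1 : ℝ) ≤ k := by exact_mod_cast hkpos
      constructor
      · nlinarith
      · intro h
        right
        have hjk : j + k = 1 := by
          by_contra hne
          have h2 : (2 : ℝ) ≤ j + k := by
            have : 2 ≤ j + k := by omega
            exact_mod_cast this
          nlinarith
        obtain rfl : k = 1 := by omega
        obtain rfl : j = 0 := by omega
        refine ⟨hts, ?_⟩
        rcases lt_trichotomy (D + 1) m with hm | hm | hm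
        · exfalso
          have h3 : ((D : ℝ) + 2) ≤ m := by exact_mod_cast hm
          push_cast at h
          rw [abs_of_nonpos (by linarith), abs_of_nonpos (by linarith),
            abs_of_nonpos (by linarith), abs_of_nonpos (by linarith)] at h
          nlinarith
        · omega
        · exfalso
          have h3 : ((m : ℝ)) ≤ D := by exact_mod_cast (by omega : m ≤ D)
          push_cast at h
          rw [abs_of_nonneg (by linarith), abs_of_nonneg (by linarith),
            abs_of_nonneg (by linarith), abs_of_nonneg (by linarith)] at h
          nlinarith
  · simp only [if_neg hts, sub_zero]
    constructor
    · rw [hbase]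
      positivity
    · intro h
      left
      rw [hbase] at h
      by_contra hne
      have hk1 : (1 : ℝ) ≤ k := by
        have : 1 ≤ k := by omega
        exact_mod_cast this
      nlinarith

namespace IsNormalForm

variable {nf : (PluckerIndex n →₀ ℕ) → MvPolynomial (PluckerIndex n) ℂ} {w₀ : PluckerIndex n → ℝ}

theorem coeff_hibi (h : IsNormalForm nf w₀) {a b : PluckerIndex n} (hab : ¬ a ≤ b)
    (hba : ¬ b ≤ a) : coeff (pairExp (a ⊓ b) (a ⊔ b)) (nf (pairExp a b)) = 1 :=
  (h.hibi_of_initialPart_mem hab hba (initialPart_mem_diagIdeal strictlyConvex_sq (by simp)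
    (h.sub_mem _))).1

theorem weight_lt_of_strictlyConvex (h : IsNormalForm nf w₀) {G : ℕ → ℕ → ℝ}
    (hG : StrictlyConvex G) (h0 : ∀ t, G t 0 = 0) {a b : PluckerIndex n} (hab : ¬ a ≤ b)
    (hba : ¬ b ≤ a) {q : PluckerIndex n →₀ ℕ} (hq : q ∈ (nf (pairExp a b)).support)
    (hne : q ≠ pairExp (a ⊓ b) (a ⊔ b)) :
    Finsupp.weight (pathWeight G) (pairExp a b) < Finsupp.weight (pathWeight G) q :=
  (h.hibi_of_initialPart_mem hab hba (initialPart_mem_diagIdeal hG h0 (h.sub_mem _))).2.2 q hq hne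

/-- All terms of a straightening relation lie outside of the interval between the meet and the
join. -/
theorem max_count_le (h : IsNormalForm nf w₀) {a b c d : PluckerIndex n} (hab : ¬ a ≤ b)
    (hba : ¬ b ≤ a) (hcd : c ≤ d) (hq : pairExp c d ∈ (nf (pairExp a b)).support)
    (hne : pairExp c d ≠ pairExp (a ⊓ b) (a ⊔ b)) {t : ℕ} (ht : t ≤ n) :
    max (a.count t) (b.count t) ≤ c.count t := by
  rcases t with _ | s
  · simp
  by_contra hlt
  push Not at hlt
  set M := max (a.count (s + 1)) (b.count (s + 1)) with hM
  have hle := (le_iff_count _ _).1 hcd (s + 1)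
  -- A hinge at place `s`, zero up to height `M - 1` by truncated subtraction, made strictly convex
  -- by a small multiple of the squares.
  let G : ℝ → ℕ → ℕ → ℝ := fun ε t x =>
    ε * (x : ℝ) ^ 2 + if t = s then ((x - (M - 1) : ℕ) : ℝ) else 0
  have hG : ∀ ε, 0 < ε → StrictlyConvex (G ε) := by
    intro ε hε t x
    have h1 : 2 * (x + 1 - (M - 1)) ≤ (x - (M - 1)) + (x + 2 - (M - 1)) := by omega
    have h2 : 2 * ((x + 1 - (M - 1) : ℕ) : ℝ) ≤
        ((x - (M - 1) : ℕ) : ℝ) + ((x + 2 - (M - 1) : ℕ) : ℝ) := by exact_mod_cast h1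
    simp only [G]
    split_ifs
    · push_cast at h2 ⊢
      nlinarith
    · push_cast
      nlinarith
  have hG0 : ∀ ε t, G ε t 0 = 0 := by
    intro ε t
    simp [G]
  set K : ℝ := ∑ t ∈ Finset.range n, ((c.count (t + 1) : ℝ) ^ 2 + (d.count (t + 1) : ℝ) ^ 2 -
        (a.count (t + 1) : ℝ) ^ 2 - (b.count (t + 1) : ℝ) ^ 2) with hK
  -- The hinge vanishes at `c` and `d` but contributes at least `1` for `a` and `b` together, so the
  -- squares would have to compensate for it however small `ε` is.
  have hpos : ∀ ε : ℝ, 0 < ε → 1 < ε * K := by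
    intro ε hε
    have h1 := h.weight_lt_of_strictlyConvex (hG ε hε) (hG0 ε) hab hba hq hne
    rw [← sub_pos, weight_pathWeight_sub] at h1
    have h2 : ∑ t ∈ Finset.range n, (G ε t (c.count (t + 1)) + G ε t (d.count (t + 1)) -
        G ε t (a.count (t + 1)) - G ε t (b.count (t + 1))) = ε * K +
        (((c.count (s + 1) - (M - 1) : ℕ) : ℝ) + ((d.count (s + 1) - (M - 1) : ℕ) : ℝ) -
        ((a.count (s + 1) - (M - 1) : ℕ) : ℝ) - ((b.count (s + 1) - (M - 1) : ℕ) : ℝ)) := by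
      rw [hK, Finset.mul_sum, ← Finset.sum_ite_eq' (Finset.range n) s
        (fun t => (((c.count (t + 1) - (M - 1) : ℕ) : ℝ) + ((d.count (t + 1) - (M - 1) : ℕ) : ℝ) -
        ((a.count (t + 1) - (M - 1) : ℕ) : ℝ) - ((b.count (t + 1) - (M - 1) : ℕ) : ℝ))) |>.trans
        (if_pos (Finset.mem_range.2 ht)), ← Finset.sum_add_distrib]
      refine Finset.sum_congr rfl fun t _ => ?_
      simp only [G]
      split_ifs
      · ring
      · ring
    rw [h2, show c.count (s + 1) - (M - 1) = 0 by omega,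
      show d.count (s + 1) - (M - 1) = 0 by omega] at h1
    have h3 : 1 ≤ (a.count (s + 1) - (M - 1)) + (b.count (s + 1) - (M - 1)) := by omega
    have h4 : (1 : ℝ) ≤ ((a.count (s + 1) - (M - 1) : ℕ) : ℝ) +
        ((b.count (s + 1) - (M - 1) : ℕ) : ℝ) := by exact_mod_cast h3
    push_cast at h1
    linarith
  have hK1 := hpos 1 one_pos
  rw [one_mul] at hK1
  have hK2 := hpos K⁻¹ (inv_pos.2 (by linarith))
  rw [inv_mul_cancel₀ (by linarith)] at hK2
  exact lt_irrefl _ hK2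

/-- A term sharing one factor with `X_a X_b` has the other in common as well, by bidegree, and `X_a
X_b` itself is not standard. -/
theorem apply_eq_zero (h : IsNormalForm nf w₀) {a b : PluckerIndex n} (hab : ¬ a ≤ b)
    (hba : ¬ b ≤ a) {q : PluckerIndex n →₀ ℕ} (hq : q ∈ (nf (pairExp a b)).support) :
    q a = 0 ∧ q b = 0 := by
  classical
  have key : ∀ c d, bidegree a + bidegree b = bidegree c + bidegree d →
      pairExp c d ∈ (nf (pairExp a b)).support → c ≠ a ∧ c ≠ b := by
    intro c d hdeg hmem
    constructor
    · rintro rfl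
      rw [← bidegree_injective (add_left_cancel hdeg)] at hmem
      exact h.self_notMem_support (nonstandard_pairExp hab hba) hmem
    · rintro rfl
      rw [add_comm] at hdeg
      rw [← bidegree_injective (add_left_cancel hdeg), pairExp_comm c a] at hmem
      exact h.self_notMem_support (nonstandard_pairExp hab hba) hmem
  obtain ⟨c, d, -, rfl, hdeg⟩ := h.exists_pairExp hq
  obtain ⟨h1, h2⟩ := key c d hdeg hq
  obtain ⟨h3, h4⟩ := key d c (by rw [hdeg, add_comm]) (by rwa [pairExp_comm d c])
  simp [pairExp, h1, h2, h3, h4]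

theorem not_nonstandard_chain {c e d : PluckerIndex n} (hce : c ≤ e) (hed : e ≤ d) :
    ¬ Nonstandard (Finsupp.single e 1 + pairExp c d) := by
  classical
  rintro ⟨x, y, hxy, hyx, hle⟩
  have hmem : ∀ z, pairExp x y z ≠ 0 → z = c ∨ z = d ∨ z = e := by
    intro z hz
    by_contra hcon
    push Not at hcon
    have h1 : (Finsupp.single e 1 + pairExp c d : PluckerIndex n →₀ ℕ) z = 0 := by
      simp [pairExp, hcon.1.symm, hcon.2.1.symm, hcon.2.2.symm]
    exact hz (Nat.le_zero.1 (h1 ▸ hle z))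
  have hx := hmem x (by simp [pairExp])
  have hy := hmem y (by simp [pairExp])
  have hcd := hce.trans hed
  rcases hx with rfl | rfl | rfl <;> rcases hy with rfl | rfl | rfl <;>
    first | exact hxy le_rfl | exact hxy (by assumption) | exact hyx (by assumption)

/-- At a weight where a single straightening term is tight, an element between the factors of this
term is comparable to the nonstandard pair. -/
theorem comparable_of_tight (h : IsNormalForm nf w₀) {w : PluckerIndex n → ℝ} (hw : Weak nf w)
    {a b c d e : PluckerIndex n} (hq : pairExp c d ∈ (nf (pairExp a b)).support)
    (hce : c ≤ e) (hed : e ≤ d)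
    (htight : Finsupp.weight w (pairExp a b) = Finsupp.weight w (pairExp c d))
    (hother : ∀ r ∈ (nf (pairExp a b)).support, r ≠ pairExp c d →
      Finsupp.weight w (pairExp a b) < Finsupp.weight w r)
    (hae : ∀ r ∈ (nf (pairExp a e)).support,
      Finsupp.weight w (pairExp a e) < Finsupp.weight w r) : False := by
  classical
  set E : PluckerIndex n →₀ ℕ := Finsupp.single e 1
  set B : PluckerIndex n →₀ ℕ := Finsupp.single b 1
  have hstd := not_nonstandard_chain hce hed
  have heq : E + pairExp a b = B + pairExp a e := by
    simp only [E, B, pairExp]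
    abel
  -- Starting with `X_a X_b`, the standard monomial `X_e X_c X_d` gets a nonzero coefficient,
  -- because the remaining terms are too heavy to produce it.
  have h1 : coeff (E + pairExp c d) (nf (E + pairExp a b)) ≠ 0 := by
    rw [h.add_eq, coeff_sum, Finset.sum_eq_single (pairExp c d)]
    · rw [h.of_standard hstd, coeff_smul, coeff_monomial, if_pos rfl, smul_eq_mul, mul_one]
      exact mem_support_iff.1 hq
    · intro r hr hrne
      rw [coeff_smul, smul_eq_mul, mul_eq_zero]
      right
      by_contra hne
      have h2 := h.weight_le hw _ _ (mem_support_iff.2 hne)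
      rw [map_add, map_add] at h2
      have h3 := hother r hr hrne
      linarith
    · exact fun h2 => absurd hq h2
  -- Starting with `X_a X_e` instead, all terms become strictly heavier than `X_e X_a X_b`, whose
  -- weight is that of `X_e X_c X_d`.
  rw [heq, ← mem_support_iff] at h1
  obtain ⟨r, hr, hmem⟩ := h.exists_of_mem_support_add h1
  have h2 := h.weight_le hw _ _ hmem
  rw [map_add, map_add] at h2
  have h3 := hae r hr
  have h4 := congrArg (Finsupp.weight w) heq
  rw [map_add, map_add] at h4
  linarith

/-! ### The two closed cones as systems of straightening inequalities. -/

/-- The straightening inequalities, indexed by a pair of incomparable elements and a term of its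
normal form. -/
structure Straightening (nf : (PluckerIndex n →₀ ℕ) → MvPolynomial (PluckerIndex n) ℂ) where
  /-- The first of two incomparable elements. -/
  left : PluckerIndex n
  /-- The second of two incomparable elements. -/
  right : PluckerIndex n
  /-- The exponent of a term of the normal form of their product. -/
  term : PluckerIndex n →₀ ℕ
  not_le : ¬ left ≤ right
  not_ge : ¬ right ≤ left
  mem : term ∈ (nf (pairExp left right)).support

instance : Finite (Straightening nf) := by
  refine Finite.of_injective (β := Σ p : PluckerIndex n × PluckerIndex n,
    (nf (pairExp p.1 p.2)).support) (fun x => ⟨(x.left, x.right), x.term, x.mem⟩) ?_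
  rintro ⟨a, b, q, _, _, _⟩ ⟨a', b', q', _, _, _⟩ h
  simp only [Sigma.mk.injEq, Prod.mk.injEq] at h
  obtain ⟨⟨rfl, rfl⟩, h2⟩ := h
  simpa using h2

/-- The functional of a straightening inequality. -/
noncomputable def gap (x : Straightening nf) : Module.Dual ℝ (PluckerIndex n → ℝ) :=
  weightFunctional x.term - weightFunctional (pairExp x.left x.right)

theorem gap_apply (x : Straightening nf) (w : PluckerIndex n → ℝ) :
    gap x w = Finsupp.weight w x.term - Finsupp.weight w (pairExp x.left x.right) := by
  rw [gap, LinearMap.sub_apply, weightFunctional_apply, weightFunctional_apply]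

/-- A straightening inequality is of Hibi type if its term is the product of meet and join. -/
def IsHibi (x : Straightening nf) : Prop :=
  x.term = pairExp (x.left ⊓ x.right) (x.left ⊔ x.right)

theorem gap_eq_zero_of_isHibi {x : Straightening nf} (hx : IsHibi x) {w : PluckerIndex n → ℝ}
    (hw : w ∈ valuations n) : gap x w = 0 := by
  rw [gap_apply, hx, weight_pairExp, weight_pairExp, hw x.left x.right, sub_self]

theorem closure_cone_nonstandard (h : IsNormalForm nf w₀) :
    closure (groebnerCone (pluckerIdeal n) (nonstandardIdeal (PluckerIndex n))) =
      {w | ∀ x : Straightening nf, 0 ≤ gap x w} := by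
  have h1 : groebnerCone (pluckerIdeal n) (nonstandardIdeal (PluckerIndex n)) =
      {w | w ∈ (⊤ : Submodule ℝ (PluckerIndex n → ℝ)) ∧ ∀ x : Straightening nf, 0 < gap x w} := by
    ext w
    constructor
    · refine fun hw => ⟨Submodule.mem_top, fun x => ?_⟩
      rw [gap_apply, sub_pos]
      exact weight_lt_of_mem_cone hw (nonstandard_pairExp x.not_le x.not_ge) (h.sub_mem _)
        (h.standard _) _ x.mem
    · rintro ⟨-, hw⟩
      refine h.mem_cone_nonstandard fun a b hab hba q hq => ?_
      have := hw ⟨a, b, q, hab, hba, hq⟩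
      rwa [gap_apply, sub_pos] at this
  have hw₀ : ∀ x : Straightening nf, 0 < gap x w₀ := fun x => by
    rw [gap_apply, sub_pos]
    exact h.weight_lt _ (nonstandard_pairExp x.not_le x.not_ge) _ x.mem
  rw [h1, closure_strict_cone ⊤ gap Submodule.mem_top hw₀]
  simp

theorem gap_pos_of_strictlyConvex (h : IsNormalForm nf w₀) {G : ℕ → ℕ → ℝ}
    (hG : StrictlyConvex G) (h0 : ∀ t, G t 0 = 0) {x : Straightening nf} (hx : ¬ IsHibi x) :
    0 < gap x (pathWeight G) := by
  rw [gap_apply, sub_pos]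
  exact h.weight_lt_of_strictlyConvex hG h0 x.not_le x.not_ge x.mem hx

/-- Hibi relations are relations between diagonal terms, so membership forces the valuation
equations and strictness for all other terms. The squares give the point satisfying all strict
inequalities that is needed to pass to the closure. -/
theorem closure_cone_hibi (h : IsNormalForm nf w₀) :
    closure (groebnerCone (pluckerIdeal n) (hibiIdeal (PluckerIndex n))) =
      {w | w ∈ valuations n ∧ ∀ x : {x : Straightening nf // ¬ IsHibi x}, 0 ≤ gap x.1 w} := by
  have h1 : groebnerCone (pluckerIdeal n) (hibiIdeal (PluckerIndex n)) =
      {w | w ∈ valuations n ∧ ∀ x : {x : Straightening nf // ¬ IsHibi x}, 0 < gap x.1 w} := by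
    ext w
    constructor
    · intro hw
      have h2 : ∀ a b : PluckerIndex n, ¬ a ≤ b → ¬ b ≤ a → _ := fun a b hab hba =>
        h.hibi_of_initialPart_mem (w := w) hab hba (hibiIdeal_le_diagIdeal
          ((mem_groebnerCone.1 hw _).1 (initialPart_mem_initialSpan w (h.sub_mem _))))
      refine ⟨fun a b => ?_, fun x => ?_⟩
      · by_cases hab : a ≤ b
        · rw [inf_eq_left.2 hab, sup_eq_right.2 hab]
        by_cases hba : b ≤ a
        · rw [inf_eq_right.2 hba, sup_eq_left.2 hba, add_comm]
        exact (h2 a b hab hba).2.1.symm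
      · rw [gap_apply, sub_pos]
        exact (h2 _ _ x.1.not_le x.1.not_ge).2.2 _ x.1.mem x.2
    · rintro ⟨hval, hw⟩
      refine h.mem_cone_hibi hval (fun a b hab hba => h.coeff_hibi hab hba)
        fun a b hab hba q hq hne => ?_
      have := hw ⟨⟨a, b, q, hab, hba, hq⟩, hne⟩
      rwa [gap_apply, sub_pos] at this
  rw [h1, closure_strict_cone (valuations n) (fun x : {x : Straightening nf // ¬ IsHibi x} =>
    gap x.1) (pathWeight_mem_valuations _)
    fun x => h.gap_pos_of_strictlyConvex strictlyConvex_sq (by simp) x.2]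

theorem gap_single [DecidableEq (PluckerIndex n)]
    (x : Straightening nf) (e : PluckerIndex n) :
    gap x (Pi.single e 1) = (x.term e : ℝ) - (pairExp x.left x.right e : ℕ) := by
  rw [gap_apply, weight_single_one, weight_single_one]

/-- The combinatorial shape of a straightening inequality which cuts out a facet of the cone of
the ideal of nonstandard monomials and is not of Hibi type. -/
theorem exists_second_difference (h : IsNormalForm nf w₀) {x : Straightening nf}
    (hx : ¬ IsHibi x) {w : PluckerIndex n → ℝ} (hw : ∀ y : Straightening nf, 0 ≤ gap y w)
    (hx0 : gap x w = 0)
    (htight : ∀ y : Straightening nf, gap y w = 0 → ∃ s : ℝ, 0 < s ∧ gap y = s • gap x) :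
    ∃ s m : ℕ, s < n ∧ 1 ≤ m ∧ ∀ G : ℕ → ℕ → ℝ,
      gap x (pathWeight G) = G s (m + 1) + G s (m - 1) - 2 * G s m := by
  classical
  obtain ⟨a, b, q, hab, hba, hq⟩ := x
  obtain ⟨c, d, hcd, rfl, hdeg⟩ := h.exists_pairExp hq
  set x : Straightening nf := ⟨a, b, pairExp c d, hab, hba, hq⟩ with hxdef
  have hne : pairExp c d ≠ pairExp (a ⊓ b) (a ⊔ b) := hx
  have hmax := fun t (ht : t ≤ n) => h.max_count_le hab hba hcd hq hne ht
  have hsum := count_add_count_eq hdeg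
  have hca : c ≤ a := (le_iff_count' _ _).2 fun t ht => (le_max_left _ _).trans (hmax t ht)
  have hcb : c ≤ b := (le_iff_count' _ _).2 fun t ht => (le_max_right _ _).trans (hmax t ht)
  have had : a ≤ d := (le_iff_count' _ _).2 fun t ht => by
    have h1 := hmax t ht
    have h2 := hsum t ht
    omega
  have hbd : b ≤ d := (le_iff_count' _ _).2 fun t ht => by
    have h1 := hmax t ht
    have h2 := hsum t ht
    omega
  have hweak : Weak nf w := fun a' b' hab' hba' r hr => by
    have := hw ⟨a', b', r, hab', hba', hr⟩
    rwa [gap_apply, sub_nonneg] at this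
  have hweq : Finsupp.weight w (pairExp a b) = Finsupp.weight w (pairExp c d) := by
    rw [gap_apply, sub_eq_zero] at hx0
    exact hx0.symm
  have hanb : a ≠ b := fun h1 => hab h1.le
  -- No term contains `a`, so comparing the coefficients of `a` in the proportional functionals
  -- gives the factor `1` and then equal terms.
  have hother : ∀ r ∈ (nf (pairExp a b)).support, r ≠ pairExp c d →
      Finsupp.weight w (pairExp a b) < Finsupp.weight w r := by
    intro r hr hrne
    refine lt_of_le_of_ne (hweak a b hab hba r hr) fun h1 => hrne ?_
    obtain ⟨s, hs, hsy⟩ := htight ⟨a, b, r, hab, hba, hr⟩ (by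
      rw [gap_apply]
      simp only
      rw [h1, sub_self])
    have h2 : ∀ e, (r e : ℝ) - (pairExp a b e : ℕ) =
        s * ((pairExp c d e : ℕ) - (pairExp a b e : ℕ)) := fun e => by
      have := LinearMap.congr_fun hsy (Pi.single e 1)
      rw [LinearMap.smul_apply, smul_eq_mul, gap_single, gap_single] at this
      exact this
    have h3 := h2 a
    rw [(h.apply_eq_zero hab hba hr).1, (h.apply_eq_zero hab hba hq).1] at h3
    have h4 : pairExp a b a = 1 := by simp [pairExp, hanb]
    rw [h4] at h3
    have hs1 : s = 1 := by
      push_cast at h3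
      linarith
    ext e
    have h5 := h2 e
    rw [hs1, one_mul] at h5
    have h6 : (r e : ℝ) = (pairExp c d e : ℕ) := by linarith
    exact_mod_cast h6
  -- The variable `e` has coefficient `-1` in the new functional but a nonnegative one in every
  -- positive multiple of `gap x`, so the new inequality cannot be tight.
  have hcomp : ∀ a' e, (a' = a ∨ a' = b) → e ≠ a → e ≠ b → ¬ a' ≤ e → ¬ e ≤ a' →
      ∀ r ∈ (nf (pairExp a' e)).support,
        Finsupp.weight w (pairExp a' e) < Finsupp.weight w r := by
    intro a' e ha' hea heb hae hea' r hr
    refine lt_of_le_of_ne (hweak a' e hae hea' r hr) fun h1 => ?_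
    obtain ⟨s, hs, hsy⟩ := htight ⟨a', e, r, hae, hea', hr⟩ (by
      rw [gap_apply]
      simp only
      rw [h1, sub_self])
    have h2 := LinearMap.congr_fun hsy (Pi.single e 1)
    rw [LinearMap.smul_apply, smul_eq_mul, gap_single, gap_single] at h2
    simp only [hxdef] at h2
    have h3 : a' ≠ e := fun h3 => hae h3.le
    have h4 : pairExp a' e e = 1 := by simp [pairExp, h3]
    have h5 : pairExp a b e = 0 := by simp [pairExp, hea, heb]
    rw [(h.apply_eq_zero hae hea' hr).2, h4, h5] at h2
    have h6 : (0 : ℝ) ≤ s * (pairExp c d e : ℕ) := mul_nonneg hs.le (Nat.cast_nonneg _)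
    push_cast at h2
    rw [sub_zero] at h2
    linarith
  have hint : ∀ e, c ≤ e → e ≤ d → e ≠ a → e ≠ b → (a ≤ e ∨ e ≤ a) ∧ (b ≤ e ∨ e ≤ b) := by
    intro e hce hed hea heb
    constructor
    · by_contra hcon
      push Not at hcon
      exact h.comparable_of_tight hweak hq hce hed hweq hother
        (hcomp a e (Or.inl rfl) hea heb hcon.1 hcon.2)
    · by_contra hcon
      push Not at hcon
      refine h.comparable_of_tight (a := b) (b := a) hweak (by rwa [pairExp_comm]) hce hed
        (by rwa [pairExp_comm]) (fun r hr => ?_) (hcomp b e (Or.inr rfl) hea heb hcon.1 hcon.2)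
      rw [pairExp_comm b a] at hr ⊢
      exact hother r hr
  obtain ⟨y, hy, hyne⟩ : ∃ y ≤ n, c.count y ≠ max (a.count y) (b.count y) := by
    by_contra hcon
    push Not at hcon
    refine hne ?_
    have h1 : c = a ⊓ b := ext_count fun t ht => by rw [hcon t ht, count_inf _ _ ht]
    have h2 : d = a ⊔ b := ext_count fun t ht => by
      have h3 := hcon t ht
      have h4 := hsum t ht
      rw [count_sup _ _ ht]
      omega
    rw [h1, h2]
  have hylt := lt_of_le_of_ne (hmax y hy) (Ne.symm hyne)
  obtain ⟨hyn, h1, h2, h3⟩ := interval_rigid hab hba hca hcb had hbd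
    (count_end_eq_max hcd hdeg) hint hy ((le_max_left _ _).trans_lt hylt)
    ((le_max_right _ _).trans_lt hylt)
  obtain ⟨s, rfl⟩ : ∃ s, y = s + 1 := by
    rcases y with _ | s
    · simp at hylt
    · exact ⟨s, rfl⟩
  have h4 := hsum (s + 1) hy
  refine ⟨s, a.count (s + 1), by omega, by omega, fun G => ?_⟩
  rw [gap_apply]
  exact weight_pathWeight_sub_of_single hsum (by omega) rfl h1.symm h2 h3 G

/-- At a valuation which is flat at a single point only, a straightening inequality which is not
of Hibi type is either strict or given by the second difference at this point. -/
theorem gap_flatSquares (h : IsNormalForm nf w₀) {x : Straightening nf} (hx : ¬ IsHibi x)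
    (s m : ℕ) :
    0 < gap x (pathWeight (flatSquares s m)) ∨
      ∀ G, gap x (pathWeight G) = G s (m + 1) + G s (m - 1) - 2 * G s m := by
  obtain ⟨a, b, q, hab, hba, hq⟩ := x
  obtain ⟨c, d, hcd, rfl, hdeg⟩ := h.exists_pairExp hq
  have hne : pairExp c d ≠ pairExp (a ⊓ b) (a ⊔ b) := hx
  have hmax := fun t (ht : t ≤ n) => h.max_count_le hab hba hcd hq hne ht
  have hsum := count_add_count_eq hdeg
  simp only [gap_apply]
  have hgap := fun t (ht : t ∈ Finset.range n) => flatSquares_gap (s := s) (m := m) (t := t)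
    (hsum (t + 1) (Finset.mem_range.1 ht))
    ((le_max_left _ _).trans (hmax (t + 1) (Finset.mem_range.1 ht)))
    ((le_max_right _ _).trans (hmax (t + 1) (Finset.mem_range.1 ht)))
  by_cases hpos : 0 < Finsupp.weight (pathWeight (flatSquares s m)) (pairExp c d) -
      Finsupp.weight (pathWeight (flatSquares s m)) (pairExp a b)
  · exact Or.inl hpos
  right
  rw [weight_pathWeight_sub] at hpos
  -- All summands are nonnegative, so a vanishing gap puts every place into the equality case of
  -- `flatSquares_gap`.
  have hzero := (Finset.sum_eq_zero_iff_of_nonneg fun t ht => (hgap t ht).1).1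
    (le_antisymm (not_lt.1 hpos) (Finset.sum_nonneg fun t ht => (hgap t ht).1))
  have hcases := fun t ht => (hgap t ht).2 (hzero t ht)
  have hmax' : ∀ t ≤ n, t ≠ s + 1 → c.count t = max (a.count t) (b.count t) := by
    intro t ht hts
    rcases t with _ | r
    · simp
    · rcases hcases r (Finset.mem_range.2 ht) with h1 | ⟨h1, -⟩
      · exact h1
      · omega
  have hs : s < n ∧ a.count (s + 1) = m ∧ b.count (s + 1) = m ∧ c.count (s + 1) = m + 1 := by
    by_contra hcon
    refine hne ?_
    have hall : ∀ t ≤ n, c.count t = max (a.count t) (b.count t) := by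
      intro t ht
      by_cases hts : t = s + 1
      · subst hts
        rcases hcases s (Finset.mem_range.2 ht) with h1 | ⟨-, h1⟩
        · exact h1
        · exact absurd ⟨ht, h1⟩ hcon
      · exact hmax' t ht hts
    have h1 : c = a ⊓ b := ext_count fun t ht => by rw [hall t ht, count_inf _ _ ht]
    have h2 : d = a ⊔ b := ext_count fun t ht => by
      have h3 := hall t ht
      have h4 := hsum t ht
      rw [count_sup _ _ ht]
      omega
    rw [h1, h2]
  exact fun G => weight_pathWeight_sub_of_single hsum hs.1 hs.2.1 hs.2.2.1 hs.2.2.2 hmax' G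

end IsNormalForm

end PluckerIndex

open PluckerIndex PluckerIndex.IsNormalForm in
theorem mainTheorem9 (n : ℕ) (hn : 2 ≤ n) (F : Set (PluckerIndex n → ℝ))
    (hF : IsFacet F
      (closure (groebnerCone (pluckerIdeal n) (nonstandardIdeal (PluckerIndex n))))) :
    closure (groebnerCone (pluckerIdeal n) (hibiIdeal (PluckerIndex n))) ⊆ F ∨
      IsFacet (F ∩ closure (groebnerCone (pluckerIdeal n) (hibiIdeal (PluckerIndex n))))
        (closure (groebnerCone (pluckerIdeal n) (hibiIdeal (PluckerIndex n)))) := by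
  obtain ⟨w₀, hw₀⟩ : (groebnerCone (pluckerIdeal n)
      (nonstandardIdeal (PluckerIndex n))).Nonempty := by
    rw [← closure_nonempty_iff]
    obtain ⟨v, hv⟩ := hF.1
    obtain ⟨l, hl⟩ := hF.2.1 ⟨v, hv⟩
    rw [hl] at hv
    exact ⟨v, hv.1⟩
  obtain ⟨nf, h⟩ := exists_isNormalForm hw₀
  rw [h.closure_cone_nonstandard] at hF
  rw [h.closure_cone_hibi]
  obtain ⟨x, rfl, w, hwF, htight⟩ := hF.exists_inequality gap fun x => by
    rw [gap_apply, sub_pos]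
    exact h.weight_lt _ (nonstandard_pairExp x.not_le x.not_ge) _ x.mem
  have hsub : ∀ v ∈ valuations n, (∀ y : {y : Straightening nf // ¬ IsHibi y}, 0 ≤ gap y.1 v) →
      ∀ y : Straightening nf, 0 ≤ gap y v := by
    intro v hv hv' y
    by_cases hy : IsHibi y
    · exact (gap_eq_zero_of_isHibi hy hv).ge
    · exact hv' ⟨y, hy⟩
  by_cases hx : IsHibi x
  · left
    rintro v ⟨hv, hv'⟩
    exact ⟨hsub v hv hv', gap_eq_zero_of_isHibi hx hv⟩
  · right
    obtain ⟨s, m, hs, hm, hG⟩ := h.exists_second_difference hx hwF.1 hwF.2 htight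
    have hset : {v | (∀ y : Straightening nf, 0 ≤ gap y v) ∧ gap x v = 0} ∩
        {v | v ∈ valuations n ∧ ∀ y : {y : Straightening nf // ¬ IsHibi y}, 0 ≤ gap y.1 v} =
        {v | (v ∈ valuations n ∧ ∀ y : {y : Straightening nf // ¬ IsHibi y}, 0 ≤ gap y.1 v) ∧
          gap x v = 0} := by
      ext v
      constructor
      · rintro ⟨⟨-, h1⟩, h2⟩
        exact ⟨h2, h1⟩
      · rintro ⟨h1, h2⟩
        exact ⟨⟨hsub v h1.1 h1.2, h2⟩, h1⟩
    rw [hset]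
    refine isFacet_of_tight (valuations n)
      (fun y : {y : Straightening nf // ¬ IsHibi y} => gap y.1) (pathWeight_mem_valuations _)
      (fun y => h.gap_pos_of_strictlyConvex strictlyConvex_sq (by simp) y.2) ⟨x, hx⟩
      (pathWeight_mem_valuations (flatSquares s m)) ?_ ?_
    · rw [hG]
      obtain ⟨k, rfl⟩ := exists_add_of_le hm
      simp only [flatSquares, if_true, Nat.add_sub_cancel_left]
      push_cast
      rw [abs_of_nonneg (by linarith), abs_of_nonpos (by linarith), sub_self, abs_zero]
      ring
    · intro y
      refine (h.gap_flatSquares y.2 s m).imp id fun hy v hv hv0 => ?_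
      -- Every valuation is a path weight, so the two functionals, given by the same second
      -- difference, agree on all valuations.
      obtain ⟨G, rfl⟩ := exists_pathWeight_eq hv
      rw [hy, ← hG]
      exact hv0
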